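/- Fix a finite alphabet $\Sigma$. A partial mapping $r:\Sigma^*\times\Sigma^*\times\Sigma^*\to\Sigma^*$ is called \emph{FPT-computable with respect to $(\pi_1,\pi_2)$} if there are a partial computable function $f:\Sigma^*\times\Sigma^*\to\mathbb N$, a polynomial $p:\mathbb N\to\mathbb N$ and an algorithm (multi-tape Turing machine) which, on every triple $x=(u,u',y)\in\mathrm{dom}(r)$, computes $r(x)$ within time $f(u,u')\,p(|x|)$, where $f(u,u')$ is required to be defined for all $(u,u',y)\in\mathrm{dom}(r)$. (Nothing is required of the algorithm outside $\mathrm{dom}(r)$.) A \emph{case problem} $Q[S]$ consists of a language of pairs $Q\subseteq\Sigma^*\times\Sigma^*$ and an arbitrary set $S\subseteq\Sigma^*$. A case problem $Q[S]$ \emph{slice reduces} to $Q'[S']$ if there are a computably enumerable set $U\subseteq\Sigma^*\times\Sigma^*$ and a partial mapping $r:(\Sigma^*)^3\to\Sigma^*$ with $\mathrm{dom}(r)=U\times\Sigma^*$, FPT-computable with respect to $(\pi_1,\pi_2)$, such that for each $s\in S$ there is $s'\in S'$ with $(s,s')\in U$, and for all $(t,t')\in U$ and $y\in\Sigma^*$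 one has $(t,y)\in Q\Leftrightarrow(t',r(t,t',y))\in Q'$. A \emph{measure} is a mapping $m:\Sigma^*\times\Sigma^*\to\mathbb N$ for which there are a computable function $f:\Sigma^*\to\mathbb N$ and a polynomial $p:\mathbb N\to\mathbb N$ with $m(s,y)\le|y|\le f(s)\,p(m(s,y))$ for all $s,y\in\Sigma^*$. An \emph{accordion reduction} with respect to $Q\subseteq\Sigma^*\times\Sigma^*$ is a triple $(C,m,r)$, together with a partial function $B$, where $C\subseteq\Sigma^*\times\Sigma^*$ is computably enumerable, $m$ is a measure, $B:\Sigma^*\times\Sigma^*\to\mathbb N$ is partial computable with $\mathrm{dom}(B)=C$, and $r:(\Sigma^*)^3\to\Sigma^*$ is a partial mapping with $\mathrm{dom}(r)=C\times\Sigma^*$, FPT-computable with respect to $(\pi_1,\pi_2)$, such that for all $(u,u')\in C$ and $y\in\Sigma^*$: $m(u',r(u,u',y))\le B(u,u')\,m(u,y)$ (measure-linearity), and $(u,y)\in Q\Leftrightarrow(u',r(u,u',y))\in Q$. For $C\subseteq\Sigma^*\times\Sigma^*$ and $S\subseteq\Sigma^*$, let $\mathrm{closure}_C(S)$ be the intersection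 of all sets $T\supseteq S$ such that $(u,u')\in C$ and $u'\in T$ imply $u\in T$. \textbf{Theorem.} Let $(C,m,r)$ be an accordion reduction with respect to a language of pairs $Q\subseteq\Sigma^*\times\Sigma^*$, and let $S\subseteq\Sigma^*$. Then the case problem $Q[\mathrm{closure}_C(S)]$ slice reduces to the case problem $Q[S]$. Moreover, iterated compositions of $r$ stay FPT-computable: if $c$ is a partial computable function that maps each pair $(u,u')$ in its domain to a sequence $u=u_1,\dots,u_k=u'$ (with $k\ge1$ depending on $(u,u')$) such that $(u_i,u_{i+1})\in C$ for $1\le i<k$, then the partial mapping that sends $(u,u',y)$, for $(u,u')\in\mathrm{dom}(c)$ and $y\in\Sigma^*$, to $y_k$, where $y_1=y$ and $y_{i+1}=r(u_i,u_{i+1},y_i)$, is FPT-computable with respect to $(\pi_1,\pi_2)$. -/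

import Mathlib

/-! Strings over the alphabet `α` are elements of `List α`; a language of pairs is a
`Set (List α × List α)`. Computability is Mathlib's (`Computable`, `Partrec`, `REPred`), and
algorithms with a running time are Mathlib's multi-stack Turing machines (`Turing.FinTM2`). -/

/-- The triple `(u, u', y)` written on an input tape, as a string over `α` with one additional
separator symbol `none`: `u # u' # y`. -/
def encTriple {α : Type} (x : List α × List α × List α) : List (Option α) :=
  x.1.map some ++ [none] ++ x.2.1.map some ++ [none] ++ x.2.2.map some

/-- The machine `A`, started on the input `w`, halts with output `z` within `t` steps. -/
def ComputesWithin {Γ₀ Γ₁ : Type} (A : Turing.TM2ComputableAux Γ₀ Γ₁)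
    (w : List Γ₀) (z : List Γ₁) (t : ℕ) : Prop :=
  Nonempty (Turing.TM2OutputsInTime A.tm (w.map A.inputAlphabet.symm)
    (some (z.map A.outputAlphabet.symm)) t)

/-- FPT-computability of a partial mapping `r` on triples of strings with respect to a
parameterization `κ`: on every `x` in the domain of `r`, one and the same machine computes `r x`
within time `f (κ x) * p |x|`, where `p` is a polynomial and `f` is computable. As `κ` is regarded
as a mapping on the domain of `r` only, `f` has to be defined (and given by an algorithm) only on
the parameter values `κ x` of elements `x` of that domain; nothing is required of the machine
outside of the domain of `r` (promise convention). -/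
def FPTComputable {α P : Type} [Primcodable P] (κ : List α × List α × List α → P)
    (r : List α × List α × List α →. List α) : Prop :=
  ∃ f : P →. ℕ, Partrec f ∧
    ∃ (p : Polynomial ℕ) (A : Turing.TM2ComputableAux (Option α) α),
      ∀ x ∈ r.Dom, ∃ c ∈ f (κ x), ∀ z ∈ r x,
        ComputesWithin A (encTriple x) z (c * p.eval (encTriple x).length)

/-- The parameterization `(π₁, π₂)`, which maps `(u, u', y)` to `(u, u')`. -/
def pairParam {α : Type} (x : List α × List α × List α) : List α × List α :=
  (x.1, x.2.1)

/-- A case problem `Q[S]`. -/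
structure CaseProblem (α : Type) where
  /-- the language of pairs `Q` -/
  Q : Set (List α × List α)
  /-- the set `S` of admitted first components -/
  S : Set (List α)

/-- `(U, r)` is a slice reduction from the case problem `X = Q[S]` to `Y = Q'[S']`. -/
structure IsSliceReduction {α : Type} [Primcodable α] (X Y : CaseProblem α)
    (U : Set (List α × List α)) (r : List α × List α × List α →. List α) : Prop where
  ce : REPred (fun p : List α × List α => p ∈ U)
  dom : r.Dom = {x | (x.1, x.2.1) ∈ U}
  fpt : FPTComputable pairParam r
  coverage : ∀ s ∈ X.S, ∃ s' ∈ Y.S, (s, s') ∈ U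
  correctness : ∀ t t', (t, t') ∈ U → ∀ y, ∀ z ∈ r (t, t', y), ((t, y) ∈ X.Q ↔ (t', z) ∈ Y.Q)

/-- The case problem `X` slice reduces to the case problem `Y`. -/
def SliceReduces {α : Type} [Primcodable α] (X Y : CaseProblem α) : Prop :=
  ∃ (U : Set (List α × List α)) (r : List α × List α × List α →. List α), IsSliceReduction X Y U r

/-- The closure of `S` under `C`: the intersection of all sets `T ⊇ S` such that `(u, u') ∈ C` and
`u' ∈ T` imply `u ∈ T`. -/
def clo {α : Type} (C : Set (List α × List α)) (S : Set (List α)) : Set (List α) :=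
  ⋂₀ {T | S ⊆ T ∧ ∀ u u', (u, u') ∈ C → u' ∈ T → u ∈ T}

/-- `m` is a measure: `m (s, y) ≤ |y| ≤ f s * p (m (s, y))` for some computable function `f` and
some polynomial `p`. -/
def IsMeasure {α : Type} [Primcodable α] (m : List α × List α → ℕ) : Prop :=
  ∃ f : List α → ℕ, Computable f ∧ ∃ p : Polynomial ℕ,
    ∀ s y, m (s, y) ≤ y.length ∧ y.length ≤ f s * p.eval (m (s, y))

/-- `(C, m, r)`, together with the partial function `B`, is an accordion reduction with respect to
the language of pairs `Q`. -/
structure IsAccordionReduction {α : Type} [Primcodable α] (Q : Set (List α × List α))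
    (C : Set (List α × List α)) (m : List α × List α → ℕ) (B : List α × List α →. ℕ)
    (r : List α × List α × List α →. List α) : Prop where
  ce : REPred (fun p : List α × List α => p ∈ C)
  measure : IsMeasure m
  bound_partrec : Partrec B
  bound_dom : B.Dom = C
  dom : r.Dom = {x | (x.1, x.2.1) ∈ C}
  fpt : FPTComputable pairParam r
  measure_linear : ∀ u u', (u, u') ∈ C → ∀ y, ∀ z ∈ r (u, u', y), ∀ b ∈ B (u, u'),
    m (u', z) ≤ b * m (u, y)
  correctness : ∀ u u', (u, u') ∈ C → ∀ y, ∀ z ∈ r (u, u', y), ((u, y) ∈ Q ↔ (u', z) ∈ Q)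

/-- `l` is a `C`-chain from `u` to `u'`: a sequence `u = u₁, …, u_k = u'` with `k ≥ 1` and
`(u_i, u_{i+1}) ∈ C` for `1 ≤ i < k`. -/
def IsChainFromTo {α : Type} (C : Set (List α × List α)) (u u' : List α)
    (l : List (List α)) : Prop :=
  l.IsChain (fun a b => (a, b) ∈ C) ∧ l.head? = some u ∧ l.getLast? = some u'

/-- The iterated composition of `r` along a sequence `u₁, …, u_k`: it maps `y = y₁` to `y_k`,
where `y_{i+1} = r (u_i, u_{i+1}, y_i)`. -/
def iterAlong {α : Type} (r : List α × List α × List α →. List α) :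
    List (List α) → List α → Part (List α)
  | u :: v :: l, y => (r (u, v, y)).bind (iterAlong r (v :: l))
  | [_], y => Part.some y
  | [], y => Part.some y

/-! The danger in iterating `r` along a chain is that a polynomial growth of lengths, composed once
per pair, has a degree depending on the chain. Measure-linearity prevents this. Let `s` bound the
number of pairs of the chain and all data attached to them: the values of `B`, the parameter factors
of the running time of `r`, the factors in the measure inequality and the lengths of the strings.
The measure is multiplied by at most `s` at each pair, and it starts below `|y|`, so it stays below
`s ^ s * |y|`. The polynomial `q` of the measure inequality is applied to this bound only once:
every later string has length at most `s * q(s ^ s * |y|)`. This is `exists_chainRun`. Since `p(k *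
x) ≤ p(k) * x ^ deg p` for `x ≥ 1`, the resulting time splits into a computable function of `s` and
a fixed power of `|y| + 1` (`timeBound_le`).

It remains to realise this by one machine whose time factor is itself partial computable. The
partial function that gives the chain is evaluated by the machine of a code, with strings written as
binary numbers; its number of steps depends on `(u, u')` only and is found by simulation
(`exists_code_stepsIn`). `chainMachine` contains copies of this machine and of the machine `A` for
`r`, and runs `A` once per pair of the chain (`computesWithin_chainMachine`). Together this gives
`IsAccordionReduction.fptComputable_iterAlong`.

For the slice reduction, `U` consists of the pairs joined by a `C`-chain. As `C` is computably
enumerable, a chain can be searched for (`exists_partrec_chain`); every element of the closure is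
joined to an element of `S` by a chain (`exists_chain_of_mem_clo`); and membership in `Q` is
preserved along it, pair by pair. -/

namespace Turing.TM2

/-! ### Exact step counts, and copies of one machine inside another -/

theorem supportsStmt_univ {K : Type} {Γ : K → Type} {Λ σ : Type} [Fintype Λ]
    (q : Stmt Γ Λ σ) : SupportsStmt Finset.univ q := by
  induction q <;> simp_all [SupportsStmt]

section

variable {K : Type} [DecidableEq K] {Γ : K → Type} {Λ σ : Type}

/-- The machine `M` passes from the configuration `a` to `b` in exactly `n` steps. -/
def StepsIn (M : Λ → Stmt Γ Λ σ) (n : ℕ) (a b : Cfg Γ Λ σ) : Prop :=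
  (flip bind (step M))^[n] (some a) = some b

theorem StepsIn.refl (M : Λ → Stmt Γ Λ σ) (a : Cfg Γ Λ σ) : StepsIn M 0 a a := rfl

theorem StepsIn.trans {M : Λ → Stmt Γ Λ σ} {m n : ℕ} {a b c : Cfg Γ Λ σ}
    (h₁ : StepsIn M m a b) (h₂ : StepsIn M n b c) : StepsIn M (m + n) a c := by
  unfold StepsIn at *
  rw [Nat.add_comm, Function.iterate_add_apply, h₁, h₂]

theorem StepsIn.single {M : Λ → Stmt Γ Λ σ} {l : Λ} {v : σ} {S : ∀ k, List (Γ k)}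
    {b : Cfg Γ Λ σ} (h : stepAux (M l) v S = b) : StepsIn M 1 ⟨some l, v, S⟩ b :=
  congrArg some h

theorem stepsIn_succ {M : Λ → Stmt Γ Λ σ} {n : ℕ} {l : Λ} {v : σ} {S : ∀ k, List (Γ k)}
    {b : Cfg Γ Λ σ} :
    StepsIn M (n + 1) ⟨some l, v, S⟩ b ↔ StepsIn M n (stepAux (M l) v S) b :=
  Iff.rfl

theorem not_stepsIn_succ_of_halted {M : Λ → Stmt Γ Λ σ} {n : ℕ} {v : σ} {S : ∀ k, List (Γ k)}
    {b : Cfg Γ Λ σ} : ¬ StepsIn M (n + 1) ⟨none, v, S⟩ b := by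
  have h : ∀ m, (flip bind (step M))^[m] none = none := fun m =>
    Function.iterate_fixed rfl m
  intro hb
  exact Option.some_ne_none b (hb.symm.trans (h n))

theorem exists_stepsIn_of_reaches {M : Λ → Stmt Γ Λ σ} {a b : Cfg Γ Λ σ}
    (h : StateTransition.Reaches (step M) a b) : ∃ n, StepsIn M n a b := by
  induction h with
  | refl => exact ⟨0, rfl⟩
  | tail _ hc ih =>
    obtain ⟨n, hn⟩ := ih
    refine ⟨n + 1, ?_⟩
    unfold StepsIn at *
    rw [Function.iterate_succ_apply', hn]
    exact hc

/-! ### Translating a machine into a larger one -/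

variable {K' : Type} [DecidableEq K'] {Γ' : K' → Type} {Λ' σ' : Type}

/-- The statement `q`, performed on a part of the stacks and of the internal state of another
machine. Instead of halting, it jumps to the label `ret`. -/
def Stmt.translate (ι : K → K') (e : ∀ k, Γ k ≃ Γ' (ι k)) (lab : Λ → Λ') (ret : Option Λ')
    (get : σ' → σ) (set : σ → σ' → σ') : Stmt Γ Λ σ → Stmt Γ' Λ' σ'
  | .push k f q =>
      .push (ι k) (fun s => e k (f (get s))) (q.translate ι e lab ret get set)
  | .peek k f q =>
      .peek (ι k) (fun s x => set (f (get s) (x.map (e k).symm)) s)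
        (q.translate ι e lab ret get set)
  | .pop k f q =>
      .pop (ι k) (fun s x => set (f (get s) (x.map (e k).symm)) s)
        (q.translate ι e lab ret get set)
  | .load f q => .load (fun s => set (f (get s)) s) (q.translate ι e lab ret get set)
  | .branch f q₁ q₂ =>
      .branch (fun s => f (get s)) (q₁.translate ι e lab ret get set)
        (q₂.translate ι e lab ret get set)
  | .goto l => .goto fun s => lab (l (get s))
  | .halt => ret.elim .halt fun l => .goto fun _ => l

variable {ι : K → K'} {e : ∀ k, Γ k ≃ Γ' (ι k)} {lab : Λ → Λ'} {ret : Option Λ'}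
  {get : σ' → σ} {set : σ → σ' → σ'} {put : σ → σ'}
  {L : (∀ k, List (Γ k)) → ∀ k, List (Γ' k)}

/-- By induction on the statement. `L` fills the stacks of the copy and leaves the others fixed, and
`put` does the same for the internal state; so every read, write and test of the copy agrees with
the original, and only halting is replaced by the jump to `ret`. -/
theorem stepAux_translate (hget : ∀ s, get (put s) = s) (hset : ∀ s t, set t (put s) = put t)
    (hL : ∀ S k, L S (ι k) = (S k).map (e k))
    (hupd : ∀ S k x, L (Function.update S k x) = Function.update (L S) (ι k) (x.map (e k)))
    (q : Stmt Γ Λ σ) (v : σ) (S : ∀ k, List (Γ k)) :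
    stepAux (q.translate ι e lab ret get set) (put v) (L S) =
      ⟨(stepAux q v S).l.elim ret (some ∘ lab), put (stepAux q v S).var,
        L (stepAux q v S).stk⟩ := by
  have hh : ∀ S k, ((L S (ι k)).head?).map (e k).symm = (S k).head? := by
    intro S k
    rw [hL]; cases S k <;> simp
  induction q generalizing v S with
  | push k f q ih =>
    simp only [Stmt.translate, stepAux, hget]
    rw [← ih, hupd, List.map_cons, hL]
  | peek k f q ih =>
    simp only [Stmt.translate, stepAux, hget, hset, hh]
    rw [← ih]
  | pop k f q ih =>
    simp only [Stmt.translate, stepAux, hget, hset, hh]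
    rw [← ih, hupd, hL, List.map_tail]
  | load f q ih =>
    simp only [Stmt.translate, stepAux, hget, hset]
    rw [← ih]
  | branch f q₁ q₂ ih₁ ih₂ =>
    simp only [Stmt.translate, stepAux, hget]
    cases f v
    · exact ih₂ v S
    · exact ih₁ v S
  | goto l => simp [Stmt.translate, stepAux, hget]
  | halt => cases ret <;> simp [Stmt.translate, stepAux]

/-- If the machine `M'` contains a translated copy of the machine `M`, then it simulates each
halting computation of `M` step by step. -/
theorem StepsIn.translate {M : Λ → Stmt Γ Λ σ} {M' : Λ' → Stmt Γ' Λ' σ'} {supp : Finset Λ}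
    (hget : ∀ s, get (put s) = s) (hset : ∀ s t, set t (put s) = put t)
    (hL : ∀ S k, L S (ι k) = (S k).map (e k))
    (hupd : ∀ S k x, L (Function.update S k x) = Function.update (L S) (ι k) (x.map (e k)))
    (hsupp : ∀ q ∈ supp, SupportsStmt supp (M q))
    (hM : ∀ q ∈ supp, M' (lab q) = (M q).translate ι e lab ret get set)
    {n : ℕ} {q : Λ} (hq : q ∈ supp) {v v' : σ} {S S' : ∀ k, List (Γ k)}
    (h : StepsIn M n ⟨some q, v, S⟩ ⟨none, v', S'⟩) :
    StepsIn M' n ⟨some (lab q), put v, L S⟩ ⟨ret, put v', L S'⟩ := by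
  induction n generalizing q v S with
  | zero => simp [StepsIn] at h
  | succ n ih =>
    rw [stepsIn_succ] at h ⊢
    rw [hM q hq, stepAux_translate hget hset hL hupd]
    -- The copy is faithful only at labels in `supp`, so the next label has to lie there again. This
    -- makes it possible to copy a finite part of a program with infinitely many labels.
    have hs := @step_supports K Γ Λ σ ⟨q⟩ _ M supp ⟨hq, hsupp⟩ ⟨some q, v, S⟩
      (stepAux (M q) v S) rfl (Finset.some_mem_insertNone.2 hq)
    generalize stepAux (M q) v S = c at h hs
    obtain ⟨_ | l, w, T⟩ := c
    · cases n with
      | zero =>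
        simp only [StepsIn, Function.iterate_zero, id_eq, Option.some.injEq, Cfg.mk.injEq,
          true_and] at h
        obtain ⟨rfl, rfl⟩ := h
        rfl
      | succ n => exact absurd h not_stepsIn_succ_of_halted
    · exact ih (Finset.some_mem_insertNone.1 hs) h

end

end Turing.TM2

/-! ### Computability of halting times -/

namespace Primrec

variable {ι α β : Type} [Primcodable ι] [Primcodable α] [Primcodable β]

/-- The function is a finite table of primitive recursive functions. A program, as an arbitrary
assignment of statements to finitely many labels, is such a table. -/
theorem of_finite_left [Finite ι] {f : ι → α → β} (h : ∀ i, Primrec (f i)) : Primrec₂ f := by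
  obtain ⟨n, ⟨e⟩⟩ := Finite.exists_equiv_fin ι
  have h' : Primrec₂ fun (i : Fin n) a => f (e.symm i) a :=
    fin_curry₁.2 fun i => h (e.symm i)
  exact (h'.comp ((dom_finite e).comp fst) snd).of_eq fun p => by simp

theorem fin_update {n : ℕ} (i : Fin n) :
    Primrec₂ fun (S : Fin n → α) (a : α) => Function.update S i a := by
  refine fin_curry.2 (Primrec₂.swap (of_finite_left fun j => ?_)) |>.of_eq fun _ => rfl
  by_cases hj : j = i
  · subst hj
    exact snd.of_eq fun p => by simp
  · exact (fin_app.comp fst (const j)).of_eq fun p => by simp [hj]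

end Primrec

namespace Turing.TM2

section

variable {K : Type} [DecidableEq K] {G Λ σ : Type}

/-- A configuration of a machine with stacks numbered by `Fin m`, as a tuple. -/
def Cfg.toTuple {m : ℕ} (eK : K ≃ Fin m) (c : Cfg (fun _ : K => G) Λ σ) :
    Option Λ × σ × (Fin m → List G) :=
  (c.l, c.var, c.stk ∘ eK.symm)

/-- All functions occurring in a statement act on the finite sets of states and symbols, hence are
primitive recursive; the stacks are changed only by list operations at a fixed index. -/
theorem primrec_stepAux [Finite σ] [Finite G] [Primcodable G] [Primcodable Λ] [Primcodable σ]
    {m : ℕ} (eK : K ≃ Fin m) (q : Stmt (fun _ : K => G) Λ σ) :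
    Primrec fun x : σ × (Fin m → List G) => (stepAux q x.1 (x.2 ∘ eK)).toTuple eK := by
  have happ : ∀ k, Primrec fun x : σ × (Fin m → List G) => x.2 (eK k) := fun k =>
    Primrec.fin_app.comp Primrec.snd (Primrec.const _)
  have hupd : ∀ (S : Fin m → List G) k a,
      Function.update (S ∘ eK) k a = Function.update S (eK k) a ∘ eK := by
    intro S k a
    funext j
    by_cases hj : j = k
    · subst hj; simp
    · simp [hj]
  have hval : ∀ k (f : σ → Option G → σ),
      Primrec fun x : σ × (Fin m → List G) => f x.1 (x.2 (eK k)).head? := fun k f =>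
    (Primrec.dom_finite fun p : σ × Option G => f p.1 p.2).comp
      (Primrec.fst.pair (Primrec.list_head?.comp (happ k)))
  induction q with
  | push k f q ih =>
    exact (ih.comp (Primrec.fst.pair ((Primrec.fin_update (eK k)).comp Primrec.snd
      (Primrec.list_cons.comp ((Primrec.dom_finite f).comp Primrec.fst) (happ k))))).of_eq
      fun x => by simp only [stepAux, hupd, Function.comp_apply]
  | peek k f q ih =>
    exact (ih.comp ((hval k f).pair Primrec.snd)).of_eq fun x => by
      simp only [stepAux, Function.comp_apply]
  | pop k f q ih =>
    exact (ih.comp ((hval k f).pair ((Primrec.fin_update (eK k)).comp Primrec.snd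
      (Primrec.list_tail.comp (happ k))))).of_eq fun x => by
      simp only [stepAux, hupd, Function.comp_apply]
  | load f q ih =>
    exact (ih.comp (((Primrec.dom_finite f).comp Primrec.fst).pair Primrec.snd)).of_eq
      fun x => by simp only [stepAux]
  | branch f q₁ q₂ ih₁ ih₂ =>
    exact (Primrec.cond ((Primrec.dom_finite f).comp Primrec.fst) ih₁ ih₂).of_eq fun x => by
      simp only [stepAux]
      cases f x.1 <;> rfl
  | goto l =>
    exact ((Primrec.dom_finite fun v => some (l v)).comp Primrec.fst).pair
      (Primrec.fst.pair Primrec.snd) |>.of_eq fun x => by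
        simp [stepAux, Cfg.toTuple, Function.comp_assoc]
  | halt =>
    exact (Primrec.const none).pair (Primrec.fst.pair Primrec.snd) |>.of_eq fun x => by
        simp [stepAux, Cfg.toTuple, Function.comp_assoc]

/-- The number of steps that a finite machine makes on computably prepared stacks until it halts
is a partial computable function. -/
theorem exists_partrec_haltingTime [Finite K] [Finite Λ] [Finite σ] [Finite G] [Primcodable G]
    {β : Type} [Primcodable β] (M : Λ → Stmt (fun _ : K => G) Λ σ) (l₀ : Λ) (v₀ : σ)
    {S₀ : β → K → List G} (hS₀ : ∀ k, Computable fun b => S₀ b k) :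
    ∃ T : β →. ℕ, Partrec T ∧ ∀ b n v S,
      StepsIn M n ⟨some l₀, v₀, S₀ b⟩ ⟨none, v, S⟩ → n ∈ T b := by
  obtain ⟨m, ⟨eK⟩⟩ := Finite.exists_equiv_fin K
  obtain ⟨nΛ, ⟨eΛ⟩⟩ := Finite.exists_equiv_fin Λ
  obtain ⟨nσ, ⟨eσ⟩⟩ := Finite.exists_equiv_fin σ
  let _ : Primcodable Λ := Primcodable.ofEquiv (Fin nΛ) eΛ
  let _ : Primcodable σ := Primcodable.ofEquiv (Fin nσ) eσ
  let X := Option Λ × σ × (Fin m → List G)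
  -- Halted configurations are made fixed points, so that the iteration is total.
  let next : X → X := fun x =>
    Option.casesOn x.1 x fun l => (stepAux (M l) x.2.1 (x.2.2 ∘ eK)).toTuple eK
  have hnext : Primrec next :=
    Primrec.option_casesOn Primrec.fst Primrec.id
      ((Primrec.of_finite_left fun l => primrec_stepAux eK (M l)).comp Primrec.snd
        (Primrec.snd.comp Primrec.fst))
  let start : β → X := fun b => (some l₀, v₀, S₀ b ∘ eK.symm)
  have hstart : Computable start := by
    refine (Computable.const (some l₀)).pair ((Computable.const v₀).pair ?_)
    have : Computable fun b => List.Vector.ofFn fun i : Fin m => S₀ b (eK.symm i) :=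
      Computable.vector_ofFn fun i => hS₀ (eK.symm i)
    have h2 : Primrec fun v : List.Vector (List G) m => v.get :=
      Primrec.fin_curry.2 Primrec.vector_get
    exact (h2.to_comp.comp this).of_eq fun b => by
      funext i; simp
  have hiter : Computable₂ fun b n => next^[n] (start b) := by
    have : Primrec₂ fun (x : X) (n : ℕ) => next^[n] x :=
      Primrec.nat_iterate Primrec.snd Primrec.fst (hnext.comp₂ Primrec₂.right)
    exact this.to_comp.comp (hstart.comp Computable.fst) Computable.snd
  let halted : β → ℕ → Bool := fun b n => (next^[n] (start b)).1.isNone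
  have hhalted : Computable₂ halted :=
    ((Primrec.not.comp Primrec.option_isSome).to_comp.comp (Computable.fst.comp hiter)).of_eq
      fun p => by simp [halted]
  refine ⟨fun b => Nat.rfind fun n => Part.some (halted b n), Partrec.rfind hhalted.partrec₂, ?_⟩
  intro b n v S h
  -- Unbounded search returns the least halting time, so it must also be known that no earlier
  -- configuration has halted.
  have key : ∀ n (c : Cfg (fun _ : K => G) Λ σ), StepsIn M n c ⟨none, v, S⟩ →
      (next^[n] (c.toTuple eK)).1.isNone = true ∧
        ∀ j < n, (next^[j] (c.toTuple eK)).1.isNone = false := by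
    intro n
    induction n with
    | zero =>
      intro c hc
      simp only [StepsIn, Function.iterate_zero, id_eq, Option.some.injEq] at hc
      subst hc
      simp [Cfg.toTuple]
    | succ n ih =>
      rintro ⟨_ | l, w, R⟩ hc
      · exact absurd hc not_stepsIn_succ_of_halted
      · have hstep : next (Cfg.toTuple eK ⟨some l, w, R⟩) =
            (stepAux (M l) w R).toTuple eK := by
          simp [next, Cfg.toTuple, Function.comp_assoc]
        have := ih _ (stepsIn_succ.1 hc)
        refine ⟨by rw [Function.iterate_succ_apply, hstep]; exact this.1, fun j hj => ?_⟩
        cases j with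
        | zero => rfl
        | succ j =>
          rw [Function.iterate_succ_apply, hstep]
          exact this.2 j (by omega)
  obtain ⟨h1, h2⟩ := key n _ h
  exact Nat.mem_rfind.2 ⟨Part.mem_some_iff.2 h1.symm, fun hj => Part.mem_some_iff.2 (h2 _ hj).symm⟩

end

end Turing.TM2

/-- The preimage is found by searching all of `γ`; injectivity makes the one found the right one. -/
theorem exists_partrec_leftInverse {γ δ : Type} [Primcodable γ] [Primcodable δ] {φ : γ → δ}
    (hφ : Computable φ) (hinj : Function.Injective φ) :
    ∃ inv : δ →. γ, Partrec inv ∧ ∀ a, a ∈ inv (φ a) := by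
  classical
  let inv : δ → ℕ → Option γ := fun n k =>
    (Encodable.decode k : Option γ).bind fun w => if φ w = n then some w else none
  have hinv : Computable₂ inv := by
    refine Computable.option_bind (Computable.decode.comp Computable.snd) ?_
    have heq : Computable fun p : (δ × ℕ) × γ => decide (φ p.2 = p.1.1) :=
      (Primrec.eq (α := δ)).decide.to_comp.comp (hφ.comp Computable.snd)
        (Computable.fst.comp Computable.fst)
    exact (Computable.cond heq (Computable.option_some.comp Computable.snd)
      (Computable.const none)).of_eq fun p => by
        by_cases h : φ p.2 = p.1.1 <;> simp [h]
  refine ⟨_, Partrec.rfindOpt hinv, fun a => ?_⟩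
  have hd : (Nat.rfindOpt (inv (φ a))).Dom :=
    Nat.rfindOpt_dom.2 ⟨Encodable.encode a, a, by simp [inv]⟩
  obtain ⟨v, hv⟩ := Part.dom_iff_mem.1 hd
  obtain ⟨k, hk⟩ := Nat.rfindOpt_spec hv
  simp only [inv, Option.mem_def, Option.bind_eq_some_iff, Option.ite_none_right_eq_some,
    Option.some.injEq] at hk
  obtain ⟨v', -, hv', rfl⟩ := hk
  rwa [hinj hv'] at hv

/-! ### Strings as binary numbers, and codes acting on them -/

namespace Turing.PartrecToTM2

open ToPartrec

/-- The digits are listed from the least significant one. Zero is excluded because it has no digits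
at all. -/
theorem trNat_two_mul {n : ℕ} (hn : n ≠ 0) : trNat (2 * n) = Γ'.bit0 :: trNat n := by
  have h : ((2 * n : ℕ) : Num) = Num.bit0 n := by
    rw [two_mul, Nat.cast_add, Num.bit0_of_bit0]
  have h0 : (n : Num) ≠ 0 := by
    simpa using hn
  unfold trNat
  rw [h]
  cases hm : (n : Num) with
  | zero => exact absurd hm h0
  | pos p => rfl

theorem trNat_two_mul_add_one (n : ℕ) : trNat (2 * n + 1) = Γ'.bit1 :: trNat n := by
  have h : ((2 * n + 1 : ℕ) : Num) = Num.bit1 n := by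
    rw [two_mul, Nat.cast_add, Nat.cast_add, Nat.cast_one, Num.bit1_of_bit1]
  unfold trNat
  rw [h]
  cases (n : Num) <;> rfl

/-- The `i`-th letter of an alphabet as a block of bits. -/
def letterBits (i : ℕ) : List Γ' := List.replicate i Γ'.bit1 ++ [Γ'.bit0]

variable {β : Type} {b : ℕ}

/-- A string as a sequence of bits: the blocks of its letters, and an end marker. -/
def stringBits (e : β ≃ Fin b) (w : List β) : List Γ' :=
  w.flatMap (fun x => letterBits (e x)) ++ [Γ'.bit1]

@[simp] theorem stringBits_nil (e : β ≃ Fin b) : stringBits e [] = [Γ'.bit1] := rfl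

@[simp] theorem stringBits_cons (e : β ≃ Fin b) (x : β) (w : List β) :
    stringBits e (x :: w) = letterBits (e x) ++ stringBits e w := by
  simp [stringBits]

/-- The number whose binary digits are `stringBits e w`. -/
def stringNat (e : β ≃ Fin b) (w : List β) : ℕ :=
  w.foldr (fun x n => (fun k => 2 * k + 1)^[(e x : ℕ)] (2 * n)) 1

theorem trNat_iterate (i n : ℕ) :
    trNat ((fun k => 2 * k + 1)^[i] n) = List.replicate i Γ'.bit1 ++ trNat n := by
  induction i with
  | zero => rfl
  | succ i ih =>
    rw [Function.iterate_succ_apply', trNat_two_mul_add_one, ih]; rfl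

theorem iterate_two_mul_add_one_pos {n : ℕ} (hn : n ≠ 0) (i : ℕ) :
    (fun k => 2 * k + 1)^[i] n ≠ 0 := by
  cases i with
  | zero => exact hn
  | succ i => rw [Function.iterate_succ_apply']; omega

theorem stringNat_ne_zero (e : β ≃ Fin b) (w : List β) : stringNat e w ≠ 0 := by
  induction w with
  | nil => exact one_ne_zero
  | cons x w ih => exact iterate_two_mul_add_one_pos (mul_ne_zero two_ne_zero ih) _

/-- Prepending a bit is doubling, with or without adding one. The end marker is the leading digit 1,
so the doubled number is never zero. -/
theorem trNat_stringNat (e : β ≃ Fin b) (w : List β) :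
    trNat (stringNat e w) = stringBits e w := by
  induction w with
  | nil => exact (trNat_two_mul_add_one 0).trans (by rw [trNat_zero]; rfl)
  | cons x w ih =>
    have h : stringNat e (x :: w) = (fun k => 2 * k + 1)^[(e x : ℕ)] (2 * stringNat e w) := rfl
    rw [h, trNat_iterate, trNat_two_mul (stringNat_ne_zero e w), ih, stringBits_cons,
      letterBits, List.append_assoc]
    rfl

/-- The blocks are a prefix code: a block ends at its first zero. -/
theorem letterBits_append_inj {i j : ℕ} {l l' : List Γ'}
    (h : letterBits i ++ l = letterBits j ++ l') : i = j ∧ l = l' := by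
  induction i generalizing j with
  | zero =>
    cases j with
    | zero => simpa [letterBits] using h
    | succ j => simp [letterBits, List.replicate_succ] at h
  | succ i ih =>
    cases j with
    | zero => simp [letterBits, List.replicate_succ] at h
    | succ j =>
      simp only [letterBits, List.replicate_succ, List.cons_append, List.cons.injEq,
        true_and] at h
      have := ih h
      exact ⟨by rw [this.1], this.2⟩

theorem stringBits_ne_nil (e : β ≃ Fin b) (w : List β) : stringBits e w ≠ [] := by
  simp [stringBits]

theorem letterBits_append_stringBits_ne (e : β ≃ Fin b) (i : ℕ) (w : List β) :
    letterBits i ++ stringBits e w ≠ [Γ'.bit1] := by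
  intro h
  have := congrArg List.length h
  have h2 := List.length_pos_of_ne_nil (stringBits_ne_nil e w)
  simp [letterBits] at this
  omega

theorem stringBits_injective (e : β ≃ Fin b) : Function.Injective (stringBits e) := by
  intro w w' h
  induction w generalizing w' with
  | nil =>
    cases w' with
    | nil => rfl
    | cons x w' => exact absurd h.symm (by
        rw [stringBits_cons]; exact letterBits_append_stringBits_ne e _ _)
  | cons x w ih =>
    cases w' with
    | nil => exact absurd h (by
        rw [stringBits_cons]; exact letterBits_append_stringBits_ne e _ _)
    | cons x' w' =>
      rw [stringBits_cons, stringBits_cons] at h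
      obtain ⟨h1, h2⟩ := letterBits_append_inj h
      rw [ih h2, e.injective (Fin.ext h1)]

theorem stringNat_injective (e : β ≃ Fin b) : Function.Injective (stringNat e) := fun w w' h =>
  stringBits_injective e (by rw [← trNat_stringNat, ← trNat_stringNat, h])

variable [Primcodable β]

theorem primrec_stringNat (e : β ≃ Fin b) : Primrec (stringNat e) := by
  have : Finite β := Finite.of_equiv _ e.symm
  have h : Primrec₂ fun (_ : List β) (p : β × ℕ) =>
      (fun k => 2 * k + 1)^[(e p.1 : ℕ)] (2 * p.2) :=
    Primrec.nat_iterate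
      ((Primrec.dom_finite fun x : β => (e x : ℕ)).comp (Primrec.fst.comp Primrec.snd))
      (Primrec.nat_mul.comp (Primrec.const 2) (Primrec.snd.comp Primrec.snd))
      (Primrec.succ.comp (Primrec.nat_mul.comp (Primrec.const 2) Primrec.snd)).to₂
  exact Primrec.list_foldr Primrec.id (Primrec.const 1) h

theorem primrec_stringBits [Primcodable Γ'] (e : β ≃ Fin b) : Primrec (stringBits e) := by
  have : Finite β := Finite.of_equiv _ e.symm
  exact Primrec.list_append.comp (Primrec.list_flatMap Primrec.id
    ((Primrec.dom_finite fun x : β => letterBits (e x)).comp Primrec.snd)) (Primrec.const _)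

/-- A partial computable function on strings is evaluated by a code on the numbers of the
strings. -/
theorem exists_code_stringNat (e : β ≃ Fin b) {g : List β →. List β} (hg : Partrec g) :
    ∃ c : Code, ∀ w, ∀ w' ∈ g w, [stringNat e w'] ∈ c.eval [stringNat e w] := by
  obtain ⟨inv, hinv, hinvw⟩ := exists_partrec_leftInverse (primrec_stringNat e).to_comp
    (stringNat_injective e)
  let f : ℕ →. ℕ := fun n => ((inv n).bind g).map (stringNat e)
  have hf : Partrec f :=
    (hinv.bind (hg.comp Computable.snd).to₂).map
      ((primrec_stringNat e).to_comp.comp Computable.snd).to₂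
  obtain ⟨c, hc⟩ := Code.exists_code (Nat.Partrec'.part_iff₁.2 hf)
  refine ⟨c, fun w w' hw => ?_⟩
  have := hc ⟨[stringNat e w], rfl⟩
  rw [this]
  simp only [Part.map_eq_map, Part.mem_map_iff]
  exact ⟨stringNat e w', (Part.mem_map_iff _).2 ⟨w', Part.mem_bind_iff.2 ⟨w, hinvw w, hw⟩, rfl⟩, rfl⟩

/-- A partial computable function on strings is computed by the machine of some code, and the
number of steps is a partial computable function. -/
theorem exists_code_stepsIn (e : β ≃ Fin b) {g : List β →. List β} (hg : Partrec g) :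
    ∃ (c : Code) (T : List β →. ℕ), Partrec T ∧ ∀ w, ∀ w' ∈ g w, ∃ n ∈ T w,
      TM2.StepsIn tr n
        ⟨some (trNormal c Cont'.halt), none, K'.elim (stringBits e w ++ [Γ'.cons]) [] [] []⟩
        ⟨none, none, K'.elim (stringBits e w' ++ [Γ'.cons]) [] [] []⟩ := by
  obtain ⟨c, hc⟩ := exists_code_stringNat e hg
  obtain ⟨nΓ, ⟨eΓ⟩⟩ := Finite.exists_equiv_fin Γ'
  let _ : Primcodable Γ' := Primcodable.ofEquiv (Fin nΓ) eΓ
  have : Finite K' := Finite.of_surjective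
    (![K'.main, K'.rev, K'.aux, K'.stack] : Fin 4 → K') (by
      rintro (_ | _ | _ | _)
      exacts [⟨0, rfl⟩, ⟨1, rfl⟩, ⟨2, rfl⟩, ⟨3, rfl⟩])
  have hsup := tr_supports c Cont'.halt
  have hq : trNormal c Cont'.halt ∈ codeSupp c Cont'.halt := hsup.1
  let q₀ : {q // q ∈ codeSupp c Cont'.halt} := ⟨_, hq⟩
  -- The halting time was shown computable for finitely many labels only, so `tr` is restricted to
  -- the support of the code. The value `q₀` outside of the support is a dummy.
  let lab : Λ' → {q // q ∈ codeSupp c Cont'.halt} := fun q =>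
    if h : q ∈ codeSupp c Cont'.halt then ⟨q, h⟩ else q₀
  let M : {q // q ∈ codeSupp c Cont'.halt} → TM2.Stmt (fun _ : K' => Γ')
      {q // q ∈ codeSupp c Cont'.halt} (Option Γ') := fun q =>
    (tr q).translate (Γ' := fun _ => Γ') id (fun _ => Equiv.refl _) lab none id fun s _ => s
  have hlab : ∀ q (h : q ∈ codeSupp c Cont'.halt), lab q = ⟨q, h⟩ := fun q h => dif_pos h
  obtain ⟨T, hT, hTM⟩ := TM2.exists_partrec_haltingTime M q₀ none
    (S₀ := fun w : List β => K'.elim (stringBits e w ++ [Γ'.cons]) [] [] []) (by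
      rintro (_ | _ | _ | _)
      · exact (Primrec.list_append.comp (primrec_stringBits e) (Primrec.const _)).to_comp
      all_goals exact Computable.const [])
  refine ⟨c, T, hT, fun w w' hw => ?_⟩
  have hev : halt [stringNat e w'] ∈ StateTransition.eval (TM2.step tr) (init c [stringNat e w]) := by
    rw [tr_eval]
    exact (Part.mem_map_iff _).2 ⟨_, hc w w' hw, rfl⟩
  obtain ⟨n, hn⟩ := TM2.exists_stepsIn_of_reaches (StateTransition.mem_eval.1 hev).1
  have hlist : ∀ v : List β, trList [stringNat e v] = stringBits e v ++ [Γ'.cons] := fun v => by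
    rw [← trNat_stringNat]; rfl
  rw [init, halt, hlist, hlist] at hn
  refine ⟨n, ?_, hn⟩
  have := TM2.StepsIn.translate (M' := M) (lab := lab) (ret := none) (put := id) (L := id)
    (ι := id) (e := fun _ => Equiv.refl _) (get := id) (set := fun s _ => s)
    (fun _ => rfl) (fun _ _ => rfl) (fun S k => by simp) (fun S k x => by simp) hsup.2
    (fun q h => by rw [hlab q h]) hq hn
  rw [hlab _ hq] at this
  exact hTM w n _ _ this

end Turing.PartrecToTM2

/-! ### Time bounds, and loops that move a stack -/

namespace Turing.TM2

section

variable {K : Type} [DecidableEq K] {Γ : K → Type} {Λ σ W : Type}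

/-- The machine `M` passes from the configuration `a` to `b` within `t` steps. -/
def StepsWithin (M : Λ → Stmt Γ Λ σ) (t : ℕ) (a b : Cfg Γ Λ σ) : Prop :=
  ∃ n ≤ t, StepsIn M n a b

theorem StepsIn.within {M : Λ → Stmt Γ Λ σ} {n t : ℕ} {a b : Cfg Γ Λ σ}
    (h : StepsIn M n a b) (hn : n ≤ t) : StepsWithin M t a b :=
  ⟨n, hn, h⟩

theorem StepsWithin.trans {M : Λ → Stmt Γ Λ σ} {m n : ℕ} {a b c : Cfg Γ Λ σ}
    (h₁ : StepsWithin M m a b) (h₂ : StepsWithin M n b c) : StepsWithin M (m + n) a c := by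
  obtain ⟨i, hi, h₁⟩ := h₁
  obtain ⟨j, hj, h₂⟩ := h₂
  exact ⟨i + j, Nat.add_le_add hi hj, h₁.trans h₂⟩

theorem StepsWithin.mono {M : Λ → Stmt Γ Λ σ} {m n : ℕ} {a b : Cfg Γ Λ σ}
    (h : StepsWithin M m a b) (hmn : m ≤ n) : StepsWithin M n a b := by
  obtain ⟨i, hi, h⟩ := h
  exact ⟨i, hi.trans hmn, h⟩

/-- Pop a symbol, keep it in the second component of the state, and jump according to it. -/
def popTo (k : K) (d : Γ k → W) (g : Option W → Λ) : Stmt Γ Λ (σ × Option W) :=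
  .pop k (fun s x => (s.1, x.map d)) (.goto fun s => g s.2)

/-- Put a word on top of a stack and jump to a label. -/
def pushAll (k : K) (xs : List (Γ k)) (l : Λ) : Stmt Γ Λ σ :=
  xs.foldl (fun q x => .push k (fun _ => x) q) (.goto fun _ => l)

theorem stepAux_popTo (k : K) (d : Γ k → W) (g : Option W → Λ) (s : σ) (o : Option W)
    (S : ∀ k, List (Γ k)) :
    stepAux (popTo k d g) (s, o) S =
      ⟨some (g ((S k).head?.map d)), (s, (S k).head?.map d), Function.update S k (S k).tail⟩ :=
  rfl

theorem stepAux_pushAll (k : K) (xs : List (Γ k)) (l : Λ) (v : σ) (S : ∀ k, List (Γ k)) :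
    stepAux (pushAll k xs l) v S = ⟨some l, v, Function.update S k (xs ++ S k)⟩ := by
  have h : ∀ q : Stmt Γ Λ σ, stepAux (xs.foldl (fun q x => .push k (fun _ => x) q) q) v S =
      stepAux q v (Function.update S k (xs ++ S k)) := by
    induction xs with
    | nil => intro q; simp
    | cons x xs ih => intro q; rw [List.foldl_cons, ih]; simp [stepAux]
  exact h _

/-- A loop that moves the content of the stack `k`, reversed, to the stack `k'`. -/
theorem stepsIn_transfer {α : Type} {M : Λ → Stmt Γ Λ (σ × Option W)} {l lend : Λ} {p : α → Λ}
    {k k' : K} (hk : k ≠ k') {d : Γ k → W} {g : Option W → Λ} {e : α → Γ k} {e' : α → Γ k'}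
    (hl : M l = popTo k d g) (hg : g none = lend) (hg' : ∀ a, g (some (d (e a))) = p a)
    (hp : ∀ a, M (p a) = pushAll k' [e' a] l) (ys : List α) (s : σ) (o : Option W)
    (S : ∀ k, List (Γ k)) (hS : S k = ys.map e) :
    StepsIn M (2 * ys.length + 1) ⟨some l, (s, o), S⟩
      ⟨some lend, (s, none),
        Function.update (Function.update S k []) k' (ys.reverse.map e' ++ S k')⟩ := by
  induction ys generalizing o S with
  | nil =>
    refine StepsIn.single ?_
    rw [hl, stepAux_popTo, hS]
    have h : Function.update S k [] = S := Function.update_eq_self_iff.2 hS.symm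
    simp [hg, h]
  | cons y ys ih =>
    -- Each symbol costs a pop and a push; one more pop detects the empty stack.
    have h : 2 * (y :: ys).length + 1 = 1 + (1 + (2 * ys.length + 1)) := by
      simp; ring
    rw [h]
    refine (StepsIn.single rfl).trans ?_
    rw [hl, stepAux_popTo, hS]
    simp only [List.map_cons, List.head?_cons, Option.map_some, hg', List.tail_cons]
    refine (StepsIn.single rfl).trans ?_
    rw [hp, stepAux_pushAll]
    refine cast ?_ (ih (some (d (e y))) (Function.update (Function.update S k (ys.map e)) k'
      ([e' y] ++ Function.update S k (ys.map e) k')) ?_)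
    · congr 2
      funext j
      by_cases hj : j = k'
      · subst hj
        simp [Function.update_of_ne hk.symm]
      · by_cases hj' : j = k
        · subst hj'
          simp [hj]
        · simp [hj, hj']
    · simp [hk]

end

end Turing.TM2

/-! ### The machine that applies `A` along a computed list of pairs -/

namespace Turing

theorem initList_eq (tm : FinTM2) (l : List (tm.Γ tm.k₀)) :
    initList tm l = ⟨some tm.main, tm.initialState, Function.update (fun _ => []) tm.k₀ l⟩ := by
  unfold initList
  congr 1
  funext k
  by_cases h : k = tm.k₀
  · subst h; simp
  · simp [h]

/-- A machine halts in its initial internal state with all stacks but the output stack empty. This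
is why `A` can be restarted with no cleaning up beyond emptying that stack. -/
theorem haltList_eq (tm : FinTM2) (l : List (tm.Γ tm.k₁)) :
    haltList tm l = ⟨none, tm.initialState, Function.update (fun _ => []) tm.k₁ l⟩ := by
  unfold haltList
  congr 1
  funext k
  by_cases h : k = tm.k₁
  · subst h; simp
  · simp [h]

/-- Names of the loops that move the content of a stack to another one. -/
inductive Transfer
  | load
  | feed
  | collect
  | unfeed
  | emit

instance : Fintype Transfer :=
  ⟨⟨([.load, .feed, .collect, .unfeed, .emit] : List Transfer), by simp⟩, by rintro (_ | _) <;> simp⟩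

/-- The labels of the machine `chainMachine`. -/
inductive ChainLabel (α ΛA ΛC : Type) (n : ℕ)
  | start
  | split (j : Bool)
  | store (x : Option α) (j : Bool)
  | move (i : Transfer)
  | put (i : Transfer) (a : α)
  | code (q : ΛC)
  | read (i : Fin (n + 1))
  | act (x : Option (Option α))
  | sub (q : ΛA)
  | finish
  deriving Fintype

end Turing

namespace Turing

open PartrecToTM2 TM2

section

variable {α : Type} (A : TM2ComputableAux (Option α) α) (c : ToPartrec.Code)

/-- The stacks of `chainMachine`: those of the machine of a code, those of `A`, the input stack
`true` and a work stack `false`. -/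
abbrev ChainStack : Type := K' ⊕ A.tm.K ⊕ Bool

/-- The alphabets of the stacks of `chainMachine`. -/
abbrev ChainAlphabet : ChainStack A → Type
  | .inl _ => Γ'
  | .inr (.inl k) => A.tm.Γ k
  | .inr (.inr _) => Option α

/-- The contents of the stacks of `chainMachine`. -/
def chainStacks (C : K' → List Γ') (X : ∀ k, List (A.tm.Γ k)) (i t : List (Option α)) :
    ∀ k, List (ChainAlphabet A k)
  | .inl k => C k
  | .inr (.inl k) => X k
  | .inr (.inr true) => i
  | .inr (.inr false) => t

/-- The internal state of `chainMachine`: those of the two machines, and a symbol. -/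
abbrev ChainState : Type := (Option Γ' × A.tm.σ) × Option (Γ' ⊕ Option α)

variable {A}

theorem update_chainStacks_code (C : K' → List Γ') (X : ∀ k, List (A.tm.Γ k))
    (i t : List (Option α)) (k : K') (w : List Γ') :
    Function.update (chainStacks A C X i t) (.inl k) w =
      chainStacks A (Function.update C k w) X i t := by
  funext j
  rcases j with j | j | (_ | _) <;> simp [Function.update_apply, chainStacks]

theorem update_chainStacks_sub (C : K' → List Γ') (X : ∀ k, List (A.tm.Γ k))
    (i t : List (Option α)) (k : A.tm.K) (w : List (A.tm.Γ k)) :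
    Function.update (chainStacks A C X i t) (.inr (.inl k)) w =
      chainStacks A C (Function.update X k w) i t := by
  funext j
  rcases j with j | j | (_ | _)
  · simp [chainStacks]
  · by_cases h : j = k
    · subst h; simp [chainStacks]
    · simp [chainStacks, h]
  all_goals simp [chainStacks]

theorem update_chainStacks_input (C : K' → List Γ') (X : ∀ k, List (A.tm.Γ k))
    (i t w : List (Option α)) :
    Function.update (chainStacks A C X i t) (.inr (.inr true)) w = chainStacks A C X w t := by
  funext j
  rcases j with j | j | (_ | _) <;> simp [chainStacks]

theorem update_chainStacks_work (C : K' → List Γ') (X : ∀ k, List (A.tm.Γ k))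
    (i t w : List (Option α)) :
    Function.update (chainStacks A C X i t) (.inr (.inr false)) w = chainStacks A C X i w := by
  funext j
  rcases j with j | j | (_ | _) <;> simp [chainStacks]

variable (A) {n : ℕ}

/-- The labels of the machine of the code `c`. -/
abbrev CodeLabel : Type := {q // q ∈ codeSupp c Cont'.halt}

open Classical in
/-- A position of the machine of the code `c` as a label of `chainMachine`. -/
noncomputable def codeLabel (q : Λ') : ChainLabel α A.tm.Λ (CodeLabel c) n :=
  if h : q ∈ codeSupp c Cont'.halt then .code ⟨q, h⟩ else .finish

variable (e : Option (Option α) ≃ Fin (n + 1))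

/-- The jump after a symbol has been popped in one of the loops of `chainMachine`. -/
def transferGoto {ΛA ΛC : Type} (i : Transfer) (l : ChainLabel α ΛA ΛC n) :
    Option (Γ' ⊕ Option α) → ChainLabel α ΛA ΛC n
  | some (.inr (some a)) => .put i a
  | _ => l

/-- The program of `chainMachine`. On the input `u # u' # y`, it stores the word `u # u' #` as a
number, runs the machine of the code `c` on it, and then runs the machine `A` repeatedly: the
result of the code is read as a sequence of words `a # b #`, each of which is put in front of the
current string. -/
noncomputable def chainStmt : ChainLabel α A.tm.Λ (CodeLabel c) n →
    Stmt (ChainAlphabet A) (ChainLabel α A.tm.Λ (CodeLabel c) n) (ChainState A)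
  | .start => pushAll (.inl .main) [.bit1, .cons] (.split false)
  -- The flag `j` records whether the first separator has been read; after the second one only `y`
  -- remains on the input stack.
  | .split j => popTo (.inr (.inr true)) Sum.inr fun
      | some (.inr x) => .store x j
      | _ => .finish
  | .store x j => pushAll (.inl .main) (letterBits (e (some x))) <|
      x.elim (bif j then .move .load else .split true) fun _ => .split j
  -- The string `y` waits, reversed, on the work stack. Outputs of `A` are collected there too, so
  -- the loop `feed` serves for both and restores the order.
  | .move .load => popTo (.inr (.inr true)) Sum.inr
      (transferGoto .load (codeLabel A c (trNormal c Cont'.halt)))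
  | .move .feed => popTo (.inr (.inr false)) Sum.inr
      (transferGoto .feed (.read 0))
  | .move .collect => popTo (.inr (.inl A.tm.k₁)) (fun x => .inr (some (A.outputAlphabet x)))
      (transferGoto .collect (.move .feed))
  | .move .unfeed => popTo (.inr (.inl A.tm.k₀)) (fun x => .inr (A.inputAlphabet x))
      (transferGoto .unfeed (.move .emit))
  | .move .emit => popTo (.inr (.inr false)) Sum.inr
      (transferGoto .emit .finish)
  | .put .load a => pushAll (.inr (.inr false)) [some a] (.move .load)
  | .put .feed a => pushAll (.inr (.inl A.tm.k₀)) [A.inputAlphabet.symm (some a)] (.move .feed)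
  | .put .collect a => pushAll (.inr (.inr false)) [some a] (.move .collect)
  | .put .unfeed a => pushAll (.inr (.inr false)) [some a] (.move .unfeed)
  | .put .emit a => pushAll (.inr (.inl A.tm.k₁)) [A.outputAlphabet.symm a] (.move .emit)
  | .code q => (tr q.1).translate (Γ' := ChainAlphabet A) Sum.inl (fun _ => Equiv.refl _)
      (codeLabel A c) (some (.move .feed)) (fun s => s.1.1) fun s v => ((s, v.1.2), v.2)
  -- The index `i` counts the ones of the current block; a zero completes the letter. The symbol
  -- `cons` after the end marker shows that all pairs are done.
  | .read i => popTo (.inl .main) Sum.inl fun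
      | some (.inl .bit1) => .read (if h : i.1 + 1 < n + 1 then ⟨i.1 + 1, h⟩ else i)
      | some (.inl .bit0) => .act (e.symm i)
      | _ => .move .unfeed
  | .act (some y) => pushAll (.inr (.inl A.tm.k₀)) [A.inputAlphabet.symm y] (.read 0)
  -- The letter `none` closes a word `a # b #`: the input of `A` is now complete.
  | .act none => pushAll (.inr (.inl A.tm.k₀)) [] (.sub A.tm.main)
  | .sub q => (A.tm.m q).translate (Γ' := ChainAlphabet A) (Sum.inr ∘ Sum.inl)
      (fun _ => Equiv.refl _) .sub (some (.move .collect)) (fun s => s.1.2)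
      fun s v => ((v.1.1, s), v.2)
  | .finish => .halt

/-- A configuration of `chainMachine` between the runs of the two machines it contains. -/
def chainCfg (l : Option (ChainLabel α A.tm.Λ (CodeLabel c) n)) (o : Option (Γ' ⊕ Option α))
    (C : List Γ') (X : ∀ k, List (A.tm.Γ k)) (i t : List (Option α)) :
    Cfg (ChainAlphabet A) (ChainLabel α A.tm.Λ (CodeLabel c) n) (ChainState A) :=
  ⟨l, ((none, A.tm.initialState), o), chainStacks A (K'.elim C [] [] []) X i t⟩

variable {A c e}

theorem stepsIn_load (o : Option (Γ' ⊕ Option α)) (C : List Γ') (X : ∀ k, List (A.tm.Γ k))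
    (ys : List α) (t : List (Option α)) :
    StepsIn (chainStmt A c e) (2 * ys.length + 1)
      (chainCfg A c (some (.move .load)) o C X (ys.map some) t)
      (chainCfg A c (some (codeLabel A c (trNormal c Cont'.halt))) none C X []
        (ys.reverse.map some ++ t)) := by
  have := stepsIn_transfer (M := chainStmt A c e) (l := .move .load) (p := .put .load)
    (d := Sum.inr) (g := transferGoto .load (codeLabel A c (trNormal c Cont'.halt)))
    (k := .inr (.inr true)) (k' := .inr (.inr false)) (by simp) (e := fun a => some a)
    (e' := fun a => some a) rfl rfl (fun _ => rfl) (fun _ => rfl) ys (none, A.tm.initialState) o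
    (chainStacks A (K'.elim C [] [] []) X (ys.map some) t) rfl
  rwa [update_chainStacks_input, update_chainStacks_work] at this

theorem stepsIn_feed (o : Option (Γ' ⊕ Option α)) (C : List Γ') (X : ∀ k, List (A.tm.Γ k))
    (ys : List α) (i : List (Option α)) :
    StepsIn (chainStmt A c e) (2 * ys.length + 1)
      (chainCfg A c (some (.move .feed)) o C X i (ys.map some))
      (chainCfg A c (some (.read 0)) none C (Function.update X A.tm.k₀
        (ys.reverse.map (fun a => A.inputAlphabet.symm (some a)) ++ X A.tm.k₀)) i []) := by
  have := stepsIn_transfer (M := chainStmt A c e) (l := .move .feed) (p := .put .feed)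
    (d := Sum.inr) (g := transferGoto .feed (.read 0))
    (k := .inr (.inr false)) (k' := .inr (.inl A.tm.k₀)) (by simp) (e := fun a => some a)
    (e' := fun a => A.inputAlphabet.symm (some a)) rfl rfl (fun _ => rfl) (fun _ => rfl) ys
    (none, A.tm.initialState) o
    (chainStacks A (K'.elim C [] [] []) X i (ys.map some)) rfl
  rwa [update_chainStacks_work, update_chainStacks_sub] at this

theorem stepsIn_collect (o : Option (Γ' ⊕ Option α)) (C : List Γ')
    (ys : List α) (i t : List (Option α)) :
    StepsIn (chainStmt A c e) (2 * ys.length + 1)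
      (chainCfg A c (some (.move .collect)) o C
        (Function.update (fun _ => []) A.tm.k₁ (ys.map A.outputAlphabet.symm)) i t)
      (chainCfg A c (some (.move .feed)) none C (fun _ => []) i (ys.reverse.map some ++ t)) := by
  have := stepsIn_transfer (M := chainStmt A c e) (l := .move .collect) (p := .put .collect)
    (d := fun x => .inr (some (A.outputAlphabet x))) (g := transferGoto .collect (.move .feed))
    (k := .inr (.inl A.tm.k₁)) (k' := .inr (.inr false)) (by simp)
    (e := fun a => A.outputAlphabet.symm a)
    (e' := fun a => some a) rfl rfl
    (fun _ => by simp [transferGoto]) (fun _ => rfl) ys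
    (none, A.tm.initialState) o
    (chainStacks A (K'.elim C [] [] [])
      (Function.update (fun _ => []) A.tm.k₁ (ys.map A.outputAlphabet.symm)) i t)
    (by simp [chainStacks])
  rwa [update_chainStacks_sub, update_chainStacks_work, Function.update_idem,
    Function.update_eq_self_iff.2 rfl] at this

theorem stepsIn_unfeed (o : Option (Γ' ⊕ Option α)) (C : List Γ')
    (ys : List α) (i t : List (Option α)) :
    StepsIn (chainStmt A c e) (2 * ys.length + 1)
      (chainCfg A c (some (.move .unfeed)) o C
        (Function.update (fun _ => []) A.tm.k₀
          (ys.map fun a => A.inputAlphabet.symm (some a))) i t)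
      (chainCfg A c (some (.move .emit)) none C (fun _ => []) i (ys.reverse.map some ++ t)) := by
  have := stepsIn_transfer (M := chainStmt A c e) (l := .move .unfeed) (p := .put .unfeed)
    (d := fun x => .inr (A.inputAlphabet x)) (g := transferGoto .unfeed (.move .emit))
    (k := .inr (.inl A.tm.k₀)) (k' := .inr (.inr false)) (by simp)
    (e := fun a => A.inputAlphabet.symm (some a))
    (e' := fun a => some a) rfl rfl
    (fun _ => by simp [transferGoto]) (fun _ => rfl) ys
    (none, A.tm.initialState) o
    (chainStacks A (K'.elim C [] [] [])
      (Function.update (fun _ => []) A.tm.k₀ (ys.map fun a => A.inputAlphabet.symm (some a))) i t)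
    (by simp [chainStacks])
  rwa [update_chainStacks_sub, update_chainStacks_work, Function.update_idem,
    Function.update_eq_self_iff.2 rfl] at this

theorem stepsIn_emit (o : Option (Γ' ⊕ Option α)) (C : List Γ') (X : ∀ k, List (A.tm.Γ k))
    (ys : List α) (i : List (Option α)) :
    StepsIn (chainStmt A c e) (2 * ys.length + 1)
      (chainCfg A c (some (.move .emit)) o C X i (ys.map some))
      (chainCfg A c (some .finish) none C (Function.update X A.tm.k₁
        (ys.reverse.map A.outputAlphabet.symm ++ X A.tm.k₁)) i []) := by
  have := stepsIn_transfer (M := chainStmt A c e) (l := .move .emit) (p := .put .emit)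
    (d := Sum.inr) (g := transferGoto .emit (.finish))
    (k := .inr (.inr false)) (k' := .inr (.inl A.tm.k₁)) (by simp) (e := fun a => some a)
    (e' := fun a => A.outputAlphabet.symm a) rfl rfl (fun _ => rfl) (fun _ => rfl) ys
    (none, A.tm.initialState) o
    (chainStacks A (K'.elim C [] [] []) X i (ys.map some)) rfl
  rwa [update_chainStacks_work, update_chainStacks_sub] at this

/-- The machine of the code runs inside `chainMachine`. -/
theorem stepsIn_code {m : ℕ} {C C' : List Γ'}
    (h : StepsIn tr m ⟨some (trNormal c Cont'.halt), none, K'.elim C [] [] []⟩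
      ⟨none, none, K'.elim C' [] [] []⟩)
    (o : Option (Γ' ⊕ Option α)) (X : ∀ k, List (A.tm.Γ k)) (i t : List (Option α)) :
    StepsIn (chainStmt A c e) m
      (chainCfg A c (some (codeLabel A c (trNormal c Cont'.halt))) o C X i t)
      (chainCfg A c (some (.move .feed)) o C' X i t) := by
  have hsup := tr_supports c Cont'.halt
  exact StepsIn.translate (Γ' := ChainAlphabet A) (M' := chainStmt A c e) (lab := codeLabel A c)
    (ret := some (.move .feed))
    (put := fun s => ((s, A.tm.initialState), o)) (L := fun S => chainStacks A S X i t)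
    (ι := Sum.inl) (e := fun _ => Equiv.refl _) (get := fun s => s.1.1)
    (set := fun s v => ((s, v.1.2), v.2))
    (fun _ => rfl) (fun _ _ => rfl) (fun S k => by simp [chainStacks])
    (fun S k x => by simp [update_chainStacks_code]) hsup.2
    (fun q h => by
      have : codeLabel A c q = (ChainLabel.code ⟨q, h⟩ : ChainLabel α A.tm.Λ _ n) := dif_pos h
      rw [this]; rfl) hsup.1 h

/-- The machine `A` runs inside `chainMachine`. -/
theorem stepsWithin_sub {w : List (Option α)} {z : List α} {t : ℕ} (h : ComputesWithin A w z t)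
    (o : Option (Γ' ⊕ Option α)) (C : List Γ') (i s : List (Option α)) :
    StepsWithin (chainStmt A c e) t
      (chainCfg A c (some (.sub A.tm.main)) o C
        (Function.update (fun _ => []) A.tm.k₀ (w.map A.inputAlphabet.symm)) i s)
      (chainCfg A c (some (.move .collect)) o C
        (Function.update (fun _ => []) A.tm.k₁ (z.map A.outputAlphabet.symm)) i s) := by
  obtain ⟨⟨⟨m, hm⟩, hmt⟩⟩ := h
  rw [Option.map_some, initList_eq, haltList_eq] at hm
  refine ⟨m, hmt, ?_⟩
  let _ := A.tm.ΛFin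
  exact StepsIn.translate (Γ' := ChainAlphabet A) (M := A.tm.m) (M' := chainStmt A c e)
    (lab := ChainLabel.sub) (ret := some (.move .collect)) (supp := Finset.univ)
    (put := fun v => ((none, v), o))
    (L := fun S => chainStacks A (K'.elim C [] [] []) S i s)
    (ι := Sum.inr ∘ Sum.inl) (e := fun _ => Equiv.refl _) (get := fun s => s.1.2)
    (set := fun s v => ((v.1.1, s), v.2))
    (fun _ => rfl) (fun _ _ => rfl) (fun S k => by simp [chainStacks])
    (fun S k x => by simp [update_chainStacks_sub]) (fun _ _ => supportsStmt_univ _)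
    (fun q _ => rfl) (Finset.mem_univ _) hm

end

end Turing

/-- The pair `(u, u')` as the string `u # u' #`. -/
def encPair {α : Type} (p : List α × List α) : List (Option α) :=
  p.1.map some ++ [none] ++ p.2.map some ++ [none]

theorem encTriple_eq {α : Type} (a b y : List α) :
    encTriple (a, b, y) = encPair (a, b) ++ y.map some := rfl

theorem length_encPair {α : Type} (p : List α × List α) :
    (encPair p).length = p.1.length + p.2.length + 2 := by
  simp [encPair]; omega

/-- The input `u # u' #` of the first phase of the machine `chainMachine`, reversed. -/
def pairWord {α : Type} (p : List α × List α) : List (Option (Option α)) :=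
  (encPair p).reverse.map some

/-- A list of pairs as a sequence of words, each with an end marker. -/
def pairsWord {α : Type} (ps : List (List α × List α)) : List (Option (Option α)) :=
  ps.flatMap fun p => pairWord p ++ [none]

/-- `ChainRun A n ps y x t`: running the machine `A` for all pairs in the list `ps` transforms `y`
into `x`, and `t` is the number of steps that this takes on `chainMachine`. -/
inductive ChainRun {α : Type} (A : Turing.TM2ComputableAux (Option α) α) (n : ℕ) :
    List (List α × List α) → List α → List α → ℕ → Prop
  | nil (y : List α) : ChainRun A n [] y y (4 * y.length + 5)
  | cons {a b : List α} {ps : List (List α × List α)} {y z x : List α} {t T : ℕ}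
      (h : ComputesWithin A (encTriple (a, b, y)) z t) (hps : ChainRun A n ps z x T) :
      ChainRun A n ((a, b) :: ps) y x
        ((n + 2) * (a.length + b.length + 3) + t + 4 * z.length + 2 + T)

/-! ### Step counts of the machine -/

namespace Turing

open PartrecToTM2 TM2

section

variable {α : Type} {A : TM2ComputableAux (Option α) α} {c : ToPartrec.Code} {n : ℕ}
  {e : Option (Option α) ≃ Fin (n + 1)}

/-- The counter starts at an arbitrary `i` for the induction; as `i + j` stays in range, the cap in
the program is never met. -/
theorem stepsIn_read_bits (i j : ℕ) (hij : i + j < n + 1) (o : Option (Γ' ⊕ Option α))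
    (C : List Γ') (X : ∀ k, List (A.tm.Γ k)) (s t : List (Option α)) :
    StepsIn (chainStmt A c e) (j + 1)
      (chainCfg A c (some (.read ⟨i, by omega⟩)) o (letterBits j ++ C) X s t)
      (chainCfg A c (some (.act (e.symm ⟨i + j, hij⟩))) (some (.inl .bit0)) C X s t) := by
  induction j generalizing i o with
  | zero =>
    refine StepsIn.single ?_
    rw [chainStmt, stepAux_popTo, update_chainStacks_code]
    simp [letterBits, chainStacks, chainCfg]
  | succ j ih =>
    rw [Nat.add_comm (j + 1)]
    refine StepsIn.trans (b := chainCfg A c (some (.read ⟨i + 1, by omega⟩)) (some (.inl .bit1))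
      (letterBits j ++ C) X s t) (StepsIn.single ?_) ?_
    · rw [chainStmt, stepAux_popTo, update_chainStacks_code]
      have : i + 1 < n + 1 := by omega
      simp [letterBits, chainStacks, chainCfg, List.replicate_succ, this]
    · have := ih (i + 1) (by omega) (some (.inl .bit1))
      simpa only [Nat.add_assoc, Nat.add_comm 1 j] using this

theorem stepsWithin_read_letter (x : Option (Option α)) (o : Option (Γ' ⊕ Option α))
    (w : List (Option (Option α))) (X : ∀ k, List (A.tm.Γ k)) (s t : List (Option α)) :
    StepsWithin (chainStmt A c e) (n + 1)
      (chainCfg A c (some (.read 0)) o (stringBits e (x :: w) ++ [.cons]) X s t)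
      (chainCfg A c (some (.act x)) (some (.inl .bit0)) (stringBits e w ++ [.cons]) X s t) := by
  have h := stepsIn_read_bits (A := A) (c := c) (e := e) 0 (e x) (by have := (e x).2; omega) o
    (stringBits e w ++ [.cons]) X s t
  rw [stringBits_cons, List.append_assoc]
  refine StepsIn.within (n := (e x : ℕ) + 1) ?_ (by have := (e x).2; omega)
  simpa using h

theorem stepsWithin_read_word (l : List (Option α)) (o : Option (Γ' ⊕ Option α))
    (w : List (Option (Option α))) (v : List (Option α)) (s t : List (Option α)) :
    ∃ o', StepsWithin (chainStmt A c e) ((n + 2) * l.length)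
      (chainCfg A c (some (.read 0)) o (stringBits e (l.map some ++ w) ++ [.cons])
        (Function.update (fun _ => []) A.tm.k₀ (v.map A.inputAlphabet.symm)) s t)
      (chainCfg A c (some (.read 0)) o' (stringBits e w ++ [.cons])
        (Function.update (fun _ => []) A.tm.k₀ ((l.reverse ++ v).map A.inputAlphabet.symm))
        s t) := by
  induction l generalizing o v with
  | nil => exact ⟨o, StepsIn.within (StepsIn.refl _ _) (Nat.zero_le _)⟩
  | cons x l ih =>
    obtain ⟨o', h⟩ := ih (some (.inl .bit0)) (x :: v)
    refine ⟨o', ?_⟩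
    have h1 := stepsWithin_read_letter (A := A) (c := c) (e := e) (some x) o (l.map some ++ w)
      (Function.update (fun _ => []) A.tm.k₀ (v.map A.inputAlphabet.symm)) s t
    have h2 : StepsIn (chainStmt A c e) 1
      (chainCfg A c (some (.act (some x))) (some (.inl .bit0))
        (stringBits e (l.map some ++ w) ++ [.cons])
        (Function.update (fun _ => []) A.tm.k₀ (v.map A.inputAlphabet.symm)) s t)
      (chainCfg A c (some (.read 0)) (some (.inl .bit0))
        (stringBits e (l.map some ++ w) ++ [.cons])
        (Function.update (fun _ => []) A.tm.k₀ ((x :: v).map A.inputAlphabet.symm)) s t) := by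
      refine StepsIn.single ?_
      rw [chainStmt, stepAux_pushAll, update_chainStacks_sub]
      simp [chainStacks, chainCfg]
    have := (h1.trans (h2.within le_rfl)).trans h
    simp only [List.reverse_cons, List.append_assoc, List.singleton_append]
    refine this.mono (le_of_eq ?_)
    simp only [List.length_cons]
    ring

theorem stepsWithin_finish (o : Option (Γ' ⊕ Option α)) (y : List α) :
    StepsWithin (chainStmt A c e) (4 * y.length + 5)
      (chainCfg A c (some (.read 0)) o (stringBits e [] ++ [.cons])
        (Function.update (fun _ => []) A.tm.k₀ ((y.map some).map A.inputAlphabet.symm)) [] [])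
      (chainCfg A c none none []
        (Function.update (fun _ => []) A.tm.k₁ (y.map A.outputAlphabet.symm)) [] []) := by
  have hread : ∀ i o C X,
      StepsIn (chainStmt A c e) 1 (chainCfg A c (some (.read i)) o (.cons :: C) X [] [])
        (chainCfg A c (some (.move .unfeed)) (some (.inl .cons)) C X [] []) := by
    intro i o C X
    refine StepsIn.single ?_
    rw [chainStmt, stepAux_popTo, update_chainStacks_code]
    simp [chainStacks, chainCfg]
  have h1 : ∃ i, StepsIn (chainStmt A c e) 1
      (chainCfg A c (some (.read 0)) o (stringBits e [] ++ [.cons])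
        (Function.update (fun _ => []) A.tm.k₀ ((y.map some).map A.inputAlphabet.symm)) [] [])
      (chainCfg A c (some (.read i)) (some (.inl .bit1)) [.cons]
        (Function.update (fun _ => []) A.tm.k₀ ((y.map some).map A.inputAlphabet.symm)) [] []) := by
    -- The counter after the end marker is irrelevant: `cons` leaves the reading loop from every
    -- value.
    refine ⟨if h : (0 : Fin (n + 1)).1 + 1 < n + 1 then ⟨(0 : Fin (n + 1)).1 + 1, h⟩ else 0,
      StepsIn.single ?_⟩
    rw [chainStmt, stepAux_popTo, update_chainStacks_code]
    simp only [chainStacks, chainCfg, stringBits_nil, List.cons_append, List.nil_append,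
      K'.elim_update_main]
    rfl
  obtain ⟨i, h1⟩ := h1
  have h2 := (hread i (some (.inl .bit1)) [] (Function.update (fun _ => []) A.tm.k₀
    ((y.map some).map A.inputAlphabet.symm)))
  have h3 := stepsIn_unfeed (A := A) (c := c) (e := e) (some (.inl .cons)) [] y [] []
  have h4 := stepsIn_emit (A := A) (c := c) (e := e) none [] (fun _ => []) y.reverse []
  have h5 : StepsIn (chainStmt A c e) 1
      (chainCfg A c (some .finish) none []
        (Function.update (fun _ => []) A.tm.k₁ (y.map A.outputAlphabet.symm)) [] [])
      (chainCfg A c none none []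
        (Function.update (fun _ => []) A.tm.k₁ (y.map A.outputAlphabet.symm)) [] []) :=
    StepsIn.single rfl
  simp only [List.append_nil, List.reverse_reverse, List.map_map, Function.comp_def] at *
  exact ((((h1.trans h2).trans h3).trans h4).trans h5).within (by simp; omega)

/-- Each of the `|a| + |b| + 2` letters and the closing marker costs at most `n + 1` steps to read
and one to act upon; moving the output `z` of `A` back to its input costs two loops of `2 * |z| + 1`
steps. -/
theorem stepsWithin_of_chainRun {ps : List (List α × List α)} {y x : List α} {T : ℕ}
    (h : ChainRun A n ps y x T) (o : Option (Γ' ⊕ Option α)) :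
    StepsWithin (chainStmt A c e) T
      (chainCfg A c (some (.read 0)) o (stringBits e (pairsWord ps) ++ [.cons])
        (Function.update (fun _ => []) A.tm.k₀ ((y.map some).map A.inputAlphabet.symm)) [] [])
      (chainCfg A c none none []
        (Function.update (fun _ => []) A.tm.k₁ (x.map A.outputAlphabet.symm)) [] []) := by
  induction h generalizing o with
  | nil y => exact stepsWithin_finish o y
  | @cons a b ps y z x t T hA _ ih =>
    -- Words are stored reversed, since pushing their letters one by one on the input stack of `A`
    -- reverses them again.
    have hw : pairsWord ((a, b) :: ps) =
        (encPair (a, b)).reverse.map some ++ (none :: pairsWord ps) := by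
      simp [pairsWord, pairWord]
    obtain ⟨o', h1⟩ := stepsWithin_read_word (A := A) (c := c) (e := e) (encPair (a, b)).reverse o
      (none :: pairsWord ps) (y.map some) [] []
    rw [List.reverse_reverse, ← encTriple_eq, ← hw] at h1
    have h2 := stepsWithin_read_letter (A := A) (c := c) (e := e) none o' (pairsWord ps)
      (Function.update (fun _ => []) A.tm.k₀ ((encTriple (a, b, y)).map A.inputAlphabet.symm))
      [] []
    have h3 : StepsIn (chainStmt A c e) 1
        (chainCfg A c (some (.act none)) (some (.inl .bit0)) (stringBits e (pairsWord ps) ++ [.cons])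
          (Function.update (fun _ => []) A.tm.k₀ ((encTriple (a, b, y)).map A.inputAlphabet.symm))
          [] [])
        (chainCfg A c (some (.sub A.tm.main)) (some (.inl .bit0))
          (stringBits e (pairsWord ps) ++ [.cons])
          (Function.update (fun _ => []) A.tm.k₀ ((encTriple (a, b, y)).map A.inputAlphabet.symm))
          [] []) := by
      refine StepsIn.single ?_
      rw [chainStmt, stepAux_pushAll, update_chainStacks_sub]
      simp [chainStacks, chainCfg]
    have h4 := stepsWithin_sub (c := c) (e := e) hA (some (.inl .bit0))
      (stringBits e (pairsWord ps) ++ [.cons]) [] []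
    have h5 := stepsIn_collect (A := A) (c := c) (e := e) (some (.inl .bit0))
      (stringBits e (pairsWord ps) ++ [.cons]) z [] []
    have h6 := stepsIn_feed (A := A) (c := c) (e := e) none
      (stringBits e (pairsWord ps) ++ [.cons]) (fun _ => []) z.reverse []
    have h7 := ih none
    simp only [List.append_nil, List.reverse_reverse, List.map_map, Function.comp_def] at *
    refine ((((((h1.trans h2).trans (h3.within le_rfl)).trans h4).trans
      (h5.within le_rfl)).trans (h6.within le_rfl)).trans h7).mono ?_
    simp only [List.length_reverse, length_encPair]
    nlinarith

theorem stepsIn_split_symbol (x : Option α) (j : Bool) (o : Option (Γ' ⊕ Option α))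
    (w : List (Option (Option α))) (X : ∀ k, List (A.tm.Γ k)) (i t : List (Option α)) :
    StepsIn (chainStmt A c e) 2
      (chainCfg A c (some (.split j)) o (stringBits e w ++ [.cons]) X (x :: i) t)
      (chainCfg A c (some (x.elim (bif j then .move .load else .split true) fun _ => .split j))
        (some (.inr x)) (stringBits e (some x :: w) ++ [.cons]) X i t) := by
  refine StepsIn.trans (m := 1) (n := 1) (b := chainCfg A c (some (.store x j)) (some (.inr x))
    (stringBits e w ++ [.cons]) X i t) (StepsIn.single ?_) (StepsIn.single ?_)
  · rw [chainStmt, stepAux_popTo, update_chainStacks_input]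
    rfl
  · rw [chainStmt, stepAux_pushAll, update_chainStacks_code]
    simp [chainStacks, chainCfg]

theorem stepsIn_split_word (u : List α) (j : Bool) (o : Option (Γ' ⊕ Option α))
    (w : List (Option (Option α))) (X : ∀ k, List (A.tm.Γ k)) (i t : List (Option α)) :
    ∃ o', StepsIn (chainStmt A c e) (2 * u.length)
      (chainCfg A c (some (.split j)) o (stringBits e w ++ [.cons]) X (u.map some ++ i) t)
      (chainCfg A c (some (.split j)) o'
        (stringBits e ((u.map some).reverse.map some ++ w) ++ [.cons]) X i t) := by
  induction u generalizing o w with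
  | nil => exact ⟨o, StepsIn.refl _ _⟩
  | cons a u ih =>
    obtain ⟨o', h⟩ := ih (some (.inr (some a))) (some (some a) :: w)
    have h1 := stepsIn_split_symbol (A := A) (c := c) (e := e) (some a) j o w X (u.map some ++ i) t
    refine ⟨o', ?_⟩
    have := h1.trans h
    rw [show 2 + 2 * u.length = 2 * (a :: u).length by simp; ring] at this
    simpa using this

theorem stepsIn_prepare (u u' y : List α) :
    StepsIn (chainStmt A c e) (2 * (u.length + u'.length + y.length) + 6)
      (chainCfg A c (some .start) none [] (fun _ => []) (encTriple (u, u', y)) [])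
      (chainCfg A c (some (codeLabel A c (trNormal c Cont'.halt))) none
        (stringBits e (pairWord (u, u')) ++ [.cons]) (fun _ => []) [] (y.reverse.map some)) := by
  have h0 : StepsIn (chainStmt A c e) 1
      (chainCfg A c (some .start) none [] (fun _ => []) (encTriple (u, u', y)) [])
      (chainCfg A c (some (.split false)) none (stringBits e [] ++ [.cons]) (fun _ => [])
        (u.map some ++ (none :: (u'.map some ++ (none :: y.map some)))) []) := by
    refine StepsIn.single ?_
    rw [chainStmt, stepAux_pushAll, update_chainStacks_code]
    simp [chainStacks, chainCfg, encTriple]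
  obtain ⟨o₁, h1⟩ := stepsIn_split_word (A := A) (c := c) (e := e) u false none [] (fun _ => [])
    (none :: (u'.map some ++ (none :: y.map some))) []
  have h2 := stepsIn_split_symbol (A := A) (c := c) (e := e) none false o₁
    ((u.map some).reverse.map some ++ []) (fun _ => []) (u'.map some ++ (none :: y.map some)) []
  obtain ⟨o₂, h3⟩ := stepsIn_split_word (A := A) (c := c) (e := e) u' true (some (.inr none))
    (some none :: ((u.map some).reverse.map some ++ [])) (fun _ => []) (none :: y.map some) []
  have h4 := stepsIn_split_symbol (A := A) (c := c) (e := e) none true o₂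
    ((u'.map some).reverse.map some ++ (some none :: ((u.map some).reverse.map some ++ [])))
    (fun _ => []) (y.map some) []
  have h5 := stepsIn_load (A := A) (c := c) (e := e) (some (.inr none))
    (stringBits e (some none :: ((u'.map some).reverse.map some ++
      (some none :: ((u.map some).reverse.map some ++ [])))) ++ [.cons]) (fun _ => []) y []
  have hw : some none :: ((u'.map some).reverse.map some ++
      (some none :: ((u.map some).reverse.map some ++ []))) = pairWord (u, u') := by
    simp [pairWord, encPair]
  rw [hw] at h4 h5
  rw [List.append_nil] at h5
  have := ((((h0.trans h1).trans h2).trans h3).trans h4).trans h5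
  rw [show 1 + 2 * u.length + 2 + 2 * u'.length + 2 + (2 * y.length + 1) =
    2 * (u.length + u'.length + y.length) + 6 by ring] at this
  exact this

variable (A c e)

/-- A machine that computes, on the input `u # u' # y`, a list of pairs of strings from `u # u' #`
by the code `c`, and applies the machine `A` for all these pairs to `y`. -/
noncomputable def chainMachine [Fintype α] : FinTM2 :=
  let _ := A.tm.kFin
  let _ := A.tm.ΛFin
  let _ := A.tm.σFin
  let _ : Fintype K' :=
    ⟨⟨([.main, .rev, .aux, .stack] : List K'), by simp⟩, by rintro (_ | _) <;> simp⟩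
  { K := ChainStack A
    k₀ := .inr (.inr true)
    k₁ := .inr (.inl A.tm.k₁)
    Γ := ChainAlphabet A
    Λ := ChainLabel α A.tm.Λ (CodeLabel c) n
    main := .start
    σ := ChainState A
    initialState := ((none, A.tm.initialState), none)
    Γk₀Fin := inferInstanceAs (Fintype (Option α))
    m := chainStmt A c e }

/-- The machine `chainMachine` with its input and output alphabets. -/
noncomputable def chainMachineAux [Fintype α] : TM2ComputableAux (Option α) α where
  tm := chainMachine A c e
  inputAlphabet := Equiv.refl _
  outputAlphabet := A.outputAlphabet

variable {A c e}

theorem computesWithin_chainMachine [Fintype α] {u u' y x : List α}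
    {ps : List (List α × List α)} {m T : ℕ}
    (hc : StepsIn tr m
      ⟨some (trNormal c Cont'.halt), none,
        K'.elim (stringBits e (pairWord (u, u')) ++ [.cons]) [] [] []⟩
      ⟨none, none, K'.elim (stringBits e (pairsWord ps) ++ [.cons]) [] [] []⟩)
    (h : ChainRun A n ps y x T) :
    ComputesWithin (chainMachineAux A c e) (encTriple (u, u', y)) x
      (2 * (u.length + u'.length + y.length) + 6 + m + (2 * y.length + 1) + T) := by
  have h1 := stepsIn_prepare (A := A) (c := c) (e := e) u u' y
  have h2 := stepsIn_code (A := A) (e := e) hc none (fun _ => []) [] (y.reverse.map some)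
  have h3 := stepsIn_feed (A := A) (c := c) (e := e) none
    (stringBits e (pairsWord ps) ++ [.cons]) (fun _ => []) y.reverse []
  have h4 := stepsWithin_of_chainRun h (c := c) (e := e) none
  rw [List.reverse_reverse, List.append_nil, List.length_reverse] at h3
  rw [List.map_map] at h4
  obtain ⟨k, hk, h5⟩ := (((h1.trans h2).trans h3).within le_rfl).trans h4
  refine ⟨⟨⟨k, ?_⟩, hk⟩⟩
  rw [Option.map_some, initList_eq, haltList_eq]
  have e1 : chainCfg A c (some .start) none [] (fun _ => []) (encTriple (u, u', y)) [] =
      (⟨some .start, ((none, A.tm.initialState), none),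
        Function.update (fun _ => []) (.inr (.inr true)) (encTriple (u, u', y))⟩ :
        Cfg (ChainAlphabet A) (ChainLabel α A.tm.Λ (CodeLabel c) n) (ChainState A)) := by
    unfold chainCfg
    congr 1
    funext j
    rcases j with (_ | _ | _ | _) | j | (_ | _) <;> simp [chainStacks, K'.elim]
  have e2 : chainCfg A c none none []
        (Function.update (fun _ => []) A.tm.k₁ (x.map A.outputAlphabet.symm)) [] [] =
      (⟨none, ((none, A.tm.initialState), none),
        Function.update (fun _ => []) (.inr (.inl A.tm.k₁)) (x.map A.outputAlphabet.symm)⟩ :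
        Cfg (ChainAlphabet A) (ChainLabel α A.tm.Λ (CodeLabel c) n) (ChainState A)) := by
    unfold chainCfg
    congr 1
    funext j
    rcases j with (_ | _ | _ | _) | j | (_ | _)
    case inr.inl =>
      by_cases hj : j = A.tm.k₁
      · subst hj; simp [chainStacks]
      · simp [chainStacks, hj]
    all_goals simp [chainStacks, K'.elim]
  rw [e1, e2] at h5
  have e3 : (encTriple (u, u', y)).map (chainMachineAux A c e).inputAlphabet.symm =
    encTriple (u, u', y) := List.map_id _
  rw [e3]
  exact h5

end

end Turing

/-! ### Separating the parameter from the length in the time bound -/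

/-- For a partial computable function, a common bound for its values on the elements of a list,
and for the length of the list, is obtained by a partial computable function. -/
theorem Partrec.exists_list_bound {γ : Type} [Primcodable γ] {h : γ →. ℕ} (hh : Partrec h) :
    ∃ S : List γ →. ℕ, Partrec S ∧ ∀ l : List γ, (∀ x ∈ l, (h x).Dom) →
      ∃ s ∈ S l, l.length ≤ s ∧ ∀ x ∈ l, ∀ v ∈ h x, v ≤ s := by
  -- The sum of all values, each increased by one, dominates every value and the number of entries.
  let step : List γ → ℕ × ℕ →. ℕ := fun l p =>
    (Part.ofOption l[p.1]?).bind fun x => (h x).map fun v => p.2 + v + 1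
  have hstep : Partrec₂ step := by
    refine Partrec.bind (Computable.ofOption ?_) ?_
    · exact Computable.list_getElem?.comp Computable.fst (Computable.fst.comp Computable.snd)
    · refine Partrec.map (hh.comp Computable.snd) ?_
      exact Computable.succ.comp (Primrec.nat_add.to_comp.comp
        (Computable.snd.comp (Computable.snd.comp (Computable.fst.comp Computable.fst)))
        Computable.snd)
  refine ⟨_, Partrec.nat_rec (Primrec.list_length (α := γ)).to_comp
    (Computable.const 0).partrec hstep, fun l hl => ?_⟩
  have key : ∀ k ≤ l.length, ∃ s ∈ (Nat.rec (Part.some 0)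
      (fun y IH => IH.bind fun i => step l (y, i)) k : Part ℕ), k ≤ s ∧
      ∀ i, ∀ hi : i < l.length, i < k → ∀ v ∈ h l[i], v ≤ s := by
    intro k
    induction k with
    | zero => exact fun _ => ⟨0, Part.mem_some _, le_rfl, by simp⟩
    | succ k ih =>
      intro hk
      obtain ⟨s, hs, hks, hsv⟩ := ih (by omega)
      have hd := hl l[k] (List.getElem_mem _)
      obtain ⟨v, hv⟩ := Part.dom_iff_mem.1 hd
      refine ⟨s + v + 1, ?_, by omega, fun i hi hik w hw => ?_⟩
      · refine Part.mem_bind_iff.2 ⟨s, hs, Part.mem_bind_iff.2 ⟨l[k], ?_, ?_⟩⟩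
        · simp [List.getElem?_eq_getElem (show k < l.length by omega)]
        · exact (Part.mem_map_iff _).2 ⟨v, hv, rfl⟩
      · rcases Nat.lt_succ_iff_lt_or_eq.1 hik with h' | rfl
        · have := hsv i hi h' w hw
          omega
        · have := Part.mem_unique hv hw
          omega
  obtain ⟨s, hs, h1, h2⟩ := key l.length le_rfl
  refine ⟨s, hs, h1, fun x hx v hv => ?_⟩
  obtain ⟨i, hi, rfl⟩ := List.getElem_of_mem hx
  exact h2 i hi hi v hv

/-- This pulls the parameter `k` out of the polynomial; `1 ≤ x` lets the top power dominate the
others. -/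
theorem Polynomial.eval_nat_mul_le (p : Polynomial ℕ) (k : ℕ) {x : ℕ} (hx : 1 ≤ x) :
    p.eval (k * x) ≤ p.eval k * x ^ p.natDegree := by
  rw [Polynomial.eval_eq_sum_range, Polynomial.eval_eq_sum_range, Finset.sum_mul]
  refine Finset.sum_le_sum fun i hi => ?_
  have : x ^ i ≤ x ^ p.natDegree :=
    Nat.pow_le_pow_right hx (by simpa [Nat.lt_succ_iff] using hi)
  calc p.coeff i * (k * x) ^ i = p.coeff i * k ^ i * x ^ i := by rw [mul_pow]; ring
    _ ≤ p.coeff i * k ^ i * x ^ p.natDegree := Nat.mul_le_mul_left _ this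

theorem Polynomial.eval_nat_mono (p : Polynomial ℕ) {x y : ℕ} (h : x ≤ y) :
    p.eval x ≤ p.eval y := by
  rw [Polynomial.eval_eq_sum_range, Polynomial.eval_eq_sum_range]
  exact Finset.sum_le_sum fun i _ => Nat.mul_le_mul_left _ (Nat.pow_le_pow_left h i)

theorem Primrec.nat_pow_fun : Primrec₂ fun a b : ℕ => a ^ b :=
  Primrec₂.unpaired'.1 Nat.Primrec.pow

theorem Primrec.polynomial_eval (p : Polynomial ℕ) : Primrec fun x : ℕ => p.eval x := by
  induction p using Polynomial.induction_on' with
  | add p q hp hq => exact (Primrec.nat_add.comp hp hq).of_eq fun x => by simp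
  | monomial n a =>
    exact (Primrec.nat_mul.comp (Primrec.const a)
      (Primrec.nat_pow_fun.comp Primrec.id (Primrec.const n))).of_eq fun x => by simp

/-- The bound on the lengths of the strings in an iterated composition, in terms of a bound `s` for
the data of its pairs and of the length `k` of the first string. -/
def lengthBound (q : Polynomial ℕ) (s k : ℕ) : ℕ := k + s * q.eval (s ^ s * k)

/-- The bound on the running time of an iterated composition. -/
def timeBound (p q : Polynomial ℕ) (n s k : ℕ) : ℕ :=
  s * ((n + 2) * (s + 3) + s * p.eval (s + 2 + lengthBound q s k) + 4 * lengthBound q s k + 2) +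
    (4 * lengthBound q s k + 5)

/-- The factor of `timeBound` that does not depend on the length of the string. -/
def timeFactor (p q : Polynomial ℕ) (n s : ℕ) : ℕ :=
  s * ((n + 2) * (s + 3) + s * p.eval (s + 2 + (1 + s * q.eval (s ^ s))) +
    4 * (1 + s * q.eval (s ^ s)) + 2) + (4 * (1 + s * q.eval (s ^ s)) + 5)

theorem primrec_timeFactor (p q : Polynomial ℕ) (n : ℕ) : Primrec (timeFactor p q n) := by
  have hs : Primrec fun s : ℕ => s := Primrec.id
  have hH : Primrec fun s : ℕ => 1 + s * q.eval (s ^ s) :=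
    Primrec.nat_add.comp (.const 1) (Primrec.nat_mul.comp hs
      ((Primrec.polynomial_eval q).comp (Primrec.nat_pow_fun.comp hs hs)))
  have h4 : Primrec fun s : ℕ => 4 * (1 + s * q.eval (s ^ s)) :=
    Primrec.nat_mul.comp (.const 4) hH
  have hp : Primrec fun s : ℕ => p.eval (s + 2 + (1 + s * q.eval (s ^ s))) :=
    (Primrec.polynomial_eval p).comp
      (Primrec.nat_add.comp (Primrec.nat_add.comp hs (.const 2)) hH)
  have hn : Primrec fun s : ℕ => (n + 2) * (s + 3) :=
    Primrec.nat_mul.comp (.const _) (Primrec.nat_add.comp hs (.const 3))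
  exact Primrec.nat_add.comp (Primrec.nat_mul.comp hs (Primrec.nat_add.comp
    (Primrec.nat_add.comp (Primrec.nat_add.comp hn (Primrec.nat_mul.comp hs hp)) h4) (.const 2)))
    (Primrec.nat_add.comp h4 (.const 5))

/-- The parameter is pulled out twice, first from `q` inside the length bound and then from `p`. The
exponent therefore depends on the two degrees only, not on the chain. -/
theorem timeBound_le (p q : Polynomial ℕ) (n s k : ℕ) :
    timeBound p q n s k ≤
      timeFactor p q n s * (k + 1) ^ ((q.natDegree + 1) * (p.natDegree + 1)) := by
  set Y := k + 1 with hY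
  have hY1 : 1 ≤ Y := by omega
  set d := q.natDegree
  set E := (d + 1) * (p.natDegree + 1) with hE
  set H := 1 + s * q.eval (s ^ s) with hH
  have hYE : 1 ≤ Y ^ E := Nat.one_le_pow _ _ hY1
  have hL : lengthBound q s k ≤ H * Y ^ (d + 1) := by
    have h1 : q.eval (s ^ s * k) ≤ q.eval (s ^ s) * Y ^ d :=
      (q.eval_nat_mono (Nat.mul_le_mul_left _ (by omega))).trans (q.eval_nat_mul_le _ hY1)
    have h2 : Y ≤ Y ^ (d + 1) := Nat.le_self_pow (by omega) Y
    have h3 : Y ^ d ≤ Y ^ (d + 1) := Nat.pow_le_pow_right hY1 (by omega)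
    calc lengthBound q s k ≤ Y + s * (q.eval (s ^ s) * Y ^ d) :=
          Nat.add_le_add (by omega) (Nat.mul_le_mul_left _ h1)
      _ ≤ Y ^ (d + 1) + s * (q.eval (s ^ s) * Y ^ (d + 1)) :=
          Nat.add_le_add h2 (Nat.mul_le_mul_left _ (Nat.mul_le_mul_left _ h3))
      _ = H * Y ^ (d + 1) := by rw [hH]; ring
  have hL' : lengthBound q s k ≤ H * Y ^ E :=
    hL.trans (Nat.mul_le_mul_left _ (Nat.pow_le_pow_right hY1
      (Nat.le_mul_of_pos_right _ (Nat.succ_pos _))))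
  have hp : p.eval (s + 2 + lengthBound q s k) ≤ p.eval (s + 2 + H) * Y ^ E := by
    have h1 : s + 2 + lengthBound q s k ≤ (s + 2 + H) * Y ^ (d + 1) := by
      have : 1 ≤ Y ^ (d + 1) := Nat.one_le_pow _ _ hY1
      nlinarith
    refine (p.eval_nat_mono h1).trans ((p.eval_nat_mul_le _ (Nat.one_le_pow _ _ hY1)).trans ?_)
    rw [← pow_mul]
    exact Nat.mul_le_mul_left _ (Nat.pow_le_pow_right hY1
      (Nat.mul_le_mul_left _ (Nat.le_succ _)))
  calc timeBound p q n s k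
      ≤ s * ((n + 2) * (s + 3) * Y ^ E + s * (p.eval (s + 2 + H) * Y ^ E) + 4 * (H * Y ^ E) +
          2 * Y ^ E) + (4 * (H * Y ^ E) + 5 * Y ^ E) := by
        have hc : ∀ m, m ≤ m * Y ^ E := fun m => Nat.le_mul_of_pos_right _ hYE
        have h4 := Nat.mul_le_mul_left 4 hL'
        exact Nat.add_le_add (Nat.mul_le_mul_left _ (Nat.add_le_add (Nat.add_le_add
          (Nat.add_le_add (hc _) (Nat.mul_le_mul_left _ hp)) h4) (hc _)))
          (Nat.add_le_add h4 (hc _))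
    _ = timeFactor p q n s * Y ^ E := by
        unfold timeFactor
        rw [← hH]
        ring

theorem ComputesWithin.mono {Γ₀ Γ₁ : Type} {A : Turing.TM2ComputableAux Γ₀ Γ₁} {w : List Γ₀}
    {z : List Γ₁} {t t' : ℕ} (h : ComputesWithin A w z t) (ht : t ≤ t') :
    ComputesWithin A w z t' := by
  obtain ⟨h⟩ := h
  exact ⟨⟨h.toEvalsTo, h.steps_le_m.trans ht⟩⟩

/-! ### Iterated compositions are FPT-computable -/

section

variable {α : Type} {C : Set (List α × List α)} {r : List α × List α × List α →. List α}

/-- The data of a pair of strings in an accordion reduction that the running time depends on. -/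
def pairData (f B : List α × List α →. ℕ) (g : List α → ℕ) : List α × List α →. ℕ := fun x =>
  (f x).bind fun v => (B x).map fun b => v + b + g x.2 + x.1.length + x.2.length

theorem partrec_pairData [Primcodable α] {f B : List α × List α →. ℕ} {g : List α → ℕ}
    (hf : Partrec f) (hB : Partrec B) (hg : Computable g) : Partrec (pairData f B g) := by
  refine hf.bind (Partrec.map (hB.comp Computable.fst) ?_)
  have h1 : Computable fun x : ((List α × List α) × ℕ) × ℕ => x.1.2 + x.2 :=
    Primrec.nat_add.to_comp.comp (Computable.snd.comp Computable.fst) Computable.snd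
  have hx1 : Computable fun x : ((List α × List α) × ℕ) × ℕ => x.1.1.1 :=
    Computable.fst.comp (Computable.fst.comp Computable.fst)
  have hx2 : Computable fun x : ((List α × List α) × ℕ) × ℕ => x.1.1.2 :=
    Computable.snd.comp (Computable.fst.comp Computable.fst)
  exact Primrec.nat_add.to_comp.comp (Primrec.nat_add.to_comp.comp
    (Primrec.nat_add.to_comp.comp h1 (hg.comp hx2))
    (Primrec.list_length.to_comp.comp hx1)) (Primrec.list_length.to_comp.comp hx2)

/-- Iterated compositions of a mapping that is computed by the machine `A`, and that is linear
with respect to a measure, are computed by a run through the list of pairs, with a bound on the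
running time. -/
theorem exists_chainRun {m : List α × List α → ℕ} {f B : List α × List α →. ℕ} {g : List α → ℕ}
    {p q : Polynomial ℕ} {A : Turing.TM2ComputableAux (Option α) α} {n s N D : ℕ}
    (hA : ∀ a b y, (a, b) ∈ C → ∃ v ∈ f (a, b), ∀ z ∈ r (a, b, y),
      ComputesWithin A (encTriple (a, b, y)) z (v * p.eval (encTriple (a, b, y)).length))
    (hB : B.Dom = C)
    (hlin : ∀ u u', (u, u') ∈ C → ∀ y, ∀ z ∈ r (u, u', y), ∀ b ∈ B (u, u'),
      m (u', z) ≤ b * m (u, y))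
    (hm : ∀ u y, y.length ≤ g u * q.eval (m (u, y)))
    (hs : 1 ≤ s) (hD : s * q.eval N ≤ D) (l : List (List α)) (u y z : List α) (μ : ℕ)
    (hl : (u :: l).IsChain fun a b => (a, b) ∈ C)
    (hdata : ∀ x ∈ (u :: l).zip l, ∀ v ∈ pairData f B g x, v ≤ s)
    (hμ : m (u, y) ≤ μ) (hN : s ^ l.length * μ ≤ N) (hy : y.length ≤ D)
    (hz : z ∈ iterAlong r (u :: l) y) :
    ∃ T ≤ l.length * ((n + 2) * (s + 3) + s * p.eval (s + 2 + D) + 4 * D + 2) + (4 * D + 5),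
      ChainRun A n ((u :: l).zip l) y z T := by
  induction l generalizing u y μ with
  | nil =>
    have : z = y := Part.mem_some_iff.1 hz
    subst this
    exact ⟨_, by simp; omega, ChainRun.nil z⟩
  | cons v l ih =>
    obtain ⟨y', hy', hz'⟩ := Part.mem_bind_iff.1 hz
    rw [List.isChain_cons_cons] at hl
    obtain ⟨k, hk, hcomp⟩ := hA u v y hl.1
    have hBd : (u, v) ∈ B.Dom := hB ▸ hl.1
    obtain ⟨b, hb⟩ := Part.dom_iff_mem.1 hBd
    have hdat := hdata (u, v) (by simp) _
      (Part.mem_bind_iff.2 ⟨k, hk, (Part.mem_map_iff _).2 ⟨b, hb, rfl⟩⟩)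
    simp only at hdat
    have hμ' : m (v, y') ≤ s * μ :=
      (hlin u v hl.1 y y' hy' b hb).trans (Nat.mul_le_mul (by omega) hμ)
    -- One pair uses up one factor `s` of the budget: the power of `s` left for the remaining pairs,
    -- times the current measure bound, stays below `N`.
    have hN' : s ^ l.length * (s * μ) ≤ N := by
      rw [List.length_cons, pow_succ] at hN
      rwa [← mul_assoc]
    have hμN : s * μ ≤ N :=
      (Nat.le_mul_of_pos_left _ (Nat.pow_pos (by omega))).trans hN'
    -- The length is recovered from the measure, not from the length of the preceding string, so `q`
    -- is never composed with itself.
    have hyD : y'.length ≤ D :=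
      (hm v y').trans ((Nat.mul_le_mul (by omega) (q.eval_nat_mono (hμ'.trans hμN))).trans hD)
    obtain ⟨T, hT, hrun⟩ := ih v y' (s * μ) hl.2
      (fun x hx => hdata x (List.mem_cons_of_mem _ hx)) hμ' hN' hyD hz'
    refine ⟨_, ?_, ChainRun.cons (hcomp y' hy') hrun⟩
    have hlen : (encTriple (u, v, y)).length ≤ s + 2 + D := by
      rw [encTriple_eq, List.length_append, length_encPair, List.length_map]
      simp only
      omega
    have h1 : k * p.eval (encTriple (u, v, y)).length ≤ s * p.eval (s + 2 + D) :=
      Nat.mul_le_mul (by omega) (p.eval_nat_mono hlen)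
    have h2 : (n + 2) * (u.length + v.length + 3) ≤ (n + 2) * (s + 3) :=
      Nat.mul_le_mul_left _ (by omega)
    rw [List.length_cons, Nat.add_mul l.length 1, one_mul]
    omega

theorem isChain_iff_forall_mem_zip_tail {β : Type} {C : Set (β × β)} {l : List β} :
    l.IsChain (fun a b => (a, b) ∈ C) ↔ ∀ x ∈ l.zip l.tail, x ∈ C := by
  induction l with
  | nil => simp
  | cons u l ih =>
    cases l with
    | nil => simp
    | cons v l =>
      rw [List.isChain_cons_cons, ih]
      simp only [List.tail_cons, List.zip_cons_cons, List.mem_cons, forall_eq_or_imp]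

/-- The separator does not occur in the image of `some`, so its first occurrence determines the
splitting. -/
theorem map_some_append_none_inj {u v : List α} {w w' : List (Option α)}
    (h : u.map some ++ none :: w = v.map some ++ none :: w') : u = v ∧ w = w' := by
  induction u generalizing v with
  | nil => cases v <;> simp_all
  | cons a u ih =>
    cases v with
    | nil => simp at h
    | cons b v =>
      simp only [List.map_cons, List.cons_append, List.cons.injEq, Option.some.injEq] at h
      have := ih h.2
      exact ⟨by rw [h.1, this.1], this.2⟩

theorem pairWord_injective : Function.Injective (pairWord (α := α)) := by
  intro p p' h
  have h' : encPair p = encPair p' :=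
    List.reverse_injective (List.map_injective_iff.2 (Option.some_injective _) h)
  simp only [encPair, List.append_assoc, List.singleton_append] at h'
  obtain ⟨h1, h2⟩ := map_some_append_none_inj h'
  exact Prod.ext h1 (map_some_append_none_inj (w := []) (w' := []) h2).1

variable [Primcodable α]

theorem primrec_pairWord : Primrec (pairWord (α := α)) := by
  have hmap : Primrec fun u : List α => u.map some :=
    Primrec.list_map Primrec.id (Primrec.option_some.comp Primrec.snd).to₂
  have h : Primrec (encPair (α := α)) :=
    Primrec.list_append.comp (Primrec.list_append.comp (Primrec.list_append.comp
      (hmap.comp Primrec.fst) (Primrec.const _)) (hmap.comp Primrec.snd)) (Primrec.const _)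
  exact Primrec.list_map (Primrec.list_reverse.comp h) (Primrec.option_some.comp Primrec.snd).to₂

theorem primrec_pairsWord : Primrec (pairsWord (α := α)) :=
  Primrec.list_flatMap Primrec.id
    (Primrec.list_append.comp (primrec_pairWord.comp Primrec.snd) (Primrec.const _)).to₂

theorem primrec_zip_tail : Primrec fun l : List (List α) => l.zip l.tail := by
  have hstep : Primrec₂ fun (_ : List (List α))
      (x : List α × List (List α) × List (List α × List α)) =>
      (Option.casesOn x.2.1.head? x.2.2 fun y => (x.1, y) :: x.2.2 :
        List (List α × List α)) :=
    Primrec.option_casesOn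
      (Primrec.list_head?.comp (Primrec.fst.comp (Primrec.snd.comp Primrec.snd)))
      (Primrec.snd.comp (Primrec.snd.comp Primrec.snd))
      (Primrec.list_cons.comp
        ((Primrec.fst.comp (Primrec.snd.comp Primrec.fst)).pair Primrec.snd)
        (Primrec.snd.comp (Primrec.snd.comp (Primrec.snd.comp Primrec.fst)))).to₂
  refine (Primrec.list_rec Primrec.id (Primrec.const []) hstep).of_eq fun l => ?_
  induction l with
  | nil => rfl
  | cons x l ih =>
    simp only [id_eq] at ih ⊢
    rw [ih]
    cases l <;> simp

open Turing in
/-- Iterated compositions of the mapping of an accordion reduction stay FPT-computable. -/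
theorem IsAccordionReduction.fptComputable_iterAlong [Fintype α] {Q : Set (List α × List α)}
    {m : List α × List α → ℕ} {B : List α × List α →. ℕ} (hr : IsAccordionReduction Q C m B r)
    {c : List α × List α →. List (List α)} (hc : Partrec c)
    (hchain : ∀ u u', ∀ l ∈ c (u, u'), IsChainFromTo C u u' l) :
    FPTComputable pairParam
      (fun x => (c (x.1, x.2.1)).bind fun l => iterAlong r l x.2.2) := by
  obtain ⟨f, hf, p, A, hA⟩ := hr.fpt
  obtain ⟨g, hg, q, hq⟩ := hr.measure
  have hA' : ∀ a b y, (a, b) ∈ C → ∃ v ∈ f (a, b), ∀ z ∈ r (a, b, y),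
      ComputesWithin A (encTriple (a, b, y)) z (v * p.eval (encTriple (a, b, y)).length) :=
    fun a b y hab => hA (a, b, y) (by rw [hr.dom]; exact hab)
  obtain ⟨b, ⟨e'⟩⟩ := Finite.exists_equiv_fin (Option (Option α))
  obtain ⟨n, rfl⟩ : ∃ n, b = n + 1 := ⟨b - 1, by have := (e' none).2; omega⟩
  obtain ⟨inv, hinv, hinvw⟩ :=
    exists_partrec_leftInverse (primrec_pairWord (α := α)).to_comp pairWord_injective
  obtain ⟨cd, T, hT, hcd⟩ := PartrecToTM2.exists_code_stepsIn e'
    (g := fun w => ((inv w).bind c).map fun l => pairsWord (l.zip l.tail))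
    ((hinv.bind (hc.comp Computable.snd).to₂).map
      ((primrec_pairsWord.comp primrec_zip_tail).to_comp.comp Computable.snd).to₂)
  obtain ⟨S, hS, hSb⟩ := (partrec_pairData hf hr.bound_partrec hg).exists_list_bound
  -- The factor is obtained by computing the chain, the running time of its code and the bound `s`
  -- of its data, all from `(u, u')` alone.
  let F : List α × List α →. ℕ := fun x => (c x).bind fun l => (T (pairWord x)).bind fun t =>
    (S (l.zip l.tail)).map fun s =>
      2 * (x.1.length + x.2.length) + t + 11 + timeFactor p q n (s + 1)
  have hF : Partrec F := by
    refine hc.bind (Partrec.bind (hT.comp (primrec_pairWord.to_comp.comp Computable.fst))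
      (Partrec.map (hS.comp (primrec_zip_tail.to_comp.comp
        (Computable.snd.comp Computable.fst))) ?_))
    have hadd := Primrec.nat_add.to_comp
    have hx : Computable fun x : (((List α × List α) × List (List α)) × ℕ) × ℕ => x.1.1.1 :=
      Computable.fst.comp (Computable.fst.comp Computable.fst)
    exact hadd.comp (hadd.comp (hadd.comp
      (Primrec.nat_mul.to_comp.comp (Computable.const 2) (hadd.comp
        (Primrec.list_length.to_comp.comp (Computable.fst.comp hx))
        (Primrec.list_length.to_comp.comp (Computable.snd.comp hx))))
      (Computable.snd.comp Computable.fst)) (Computable.const 11))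
      ((primrec_timeFactor p q n).to_comp.comp (Computable.succ.comp Computable.snd))
  refine ⟨F, hF, (Polynomial.X + 1) ^ ((q.natDegree + 1) * (p.natDegree + 1)),
    chainMachineAux A cd e', ?_⟩
  rintro ⟨u, u', y⟩ hx
  obtain ⟨z₀, hz₀⟩ := Part.dom_iff_mem.1 hx
  obtain ⟨l, hl, -⟩ := Part.mem_bind_iff.1 hz₀
  simp only at hl
  obtain ⟨hl1, hl2, -⟩ := hchain u u' l hl
  obtain ⟨l, rfl⟩ : ∃ l', l = u :: l' := by
    cases l with
    | nil => simp at hl2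
    | cons v l => exact ⟨l, by simpa using hl2⟩
  obtain ⟨t, ht, hsteps⟩ := hcd (pairWord (u, u')) (pairsWord ((u :: l).zip l))
    ((Part.mem_map_iff _).2 ⟨u :: l, Part.mem_bind_iff.2 ⟨_, hinvw _, hl⟩, rfl⟩)
  have hzip := isChain_iff_forall_mem_zip_tail.1 hl1
  obtain ⟨s, hs, hsl, hsd⟩ := hSb ((u :: l).zip l) fun x hx => by
    -- The time factor `f` is known to be defined at a pair only through some triple in the domain
    -- of `r`; the empty string provides one.
    obtain ⟨v, hv, -⟩ := hA' x.1 x.2 [] (hzip x hx)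
    have hBd : x ∈ B.Dom := hr.bound_dom ▸ hzip x hx
    obtain ⟨b, hb⟩ := Part.dom_iff_mem.1 hBd
    exact Part.dom_iff_mem.2
      ⟨_, Part.mem_bind_iff.2 ⟨v, hv, (Part.mem_map_iff _).2 ⟨b, hb, rfl⟩⟩⟩
  refine ⟨_, Part.mem_bind_iff.2 ⟨u :: l, hl, Part.mem_bind_iff.2 ⟨t, ht,
    (Part.mem_map_iff _).2 ⟨s, hs, rfl⟩⟩⟩, fun z hz => ?_⟩
  obtain ⟨l', hl', hz⟩ := Part.mem_bind_iff.1 hz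
  have : l' = u :: l := Part.mem_unique hl' hl
  subst this
  have hll : l.length ≤ s := by
    have : ((u :: l).zip l).length = l.length := by simp
    omega
  have hpow : (s + 1) ^ l.length ≤ (s + 1) ^ (s + 1) := Nat.pow_le_pow_right (by omega) (by omega)
  -- The bound is `s + 1` because a positive one is needed. The initial measure is at most `|y|`,
  -- and there are at most `s` pairs, which gives `N`.
  obtain ⟨R, hR, hrun⟩ := exists_chainRun (n := n) (s := s + 1)
    (N := (s + 1) ^ (s + 1) * y.length) (D := lengthBound q (s + 1) y.length)
    hA' hr.bound_dom hr.measure_linear (fun u y => (hq u y).2) (by omega)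
    (Nat.le_add_left _ _) l u y z y.length hl1
    (fun x hx v hv => (hsd x hx v hv).trans (by omega)) (hq u y).1
    (Nat.mul_le_mul_right _ hpow) (Nat.le_add_right _ _) hz
  refine (computesWithin_chainMachine hsteps hrun).mono ?_
  have hRb : R ≤ timeBound p q n (s + 1) y.length :=
    hR.trans (Nat.add_le_add_right (Nat.mul_le_mul_right _ (by omega)) _)
  have hRf := hRb.trans (timeBound_le p q n (s + 1) y.length)
  set E := (q.natDegree + 1) * (p.natDegree + 1) with hE
  have hlen : y.length + 1 ≤ (encTriple (u, u', y)).length + 1 := by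
    rw [encTriple_eq]; simp
  have hY : y.length + 1 ≤ ((encTriple (u, u', y)).length + 1) ^ E :=
    hlen.trans (Nat.le_self_pow (by positivity) _)
  have hYE : (y.length + 1) ^ E ≤ ((encTriple (u, u', y)).length + 1) ^ E :=
    Nat.pow_le_pow_left hlen E
  simp only [Polynomial.eval_pow, Polynomial.eval_add, Polynomial.eval_X, Polynomial.eval_one]
  generalize ((encTriple (u, u', y)).length + 1) ^ E = W at hY hYE ⊢
  have h1 := hRf.trans (Nat.mul_le_mul_left _ hYE)
  have h2 : 2 * (u.length + u'.length) + t ≤ (2 * (u.length + u'.length) + t) * W :=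
    Nat.le_mul_of_pos_right _ (by omega)
  -- The constant 11 absorbs the remaining `4 * |y| + 7` steps, which are at most `11 * (|y| + 1)`.
  change _ ≤ (2 * (u.length + u'.length) + t + 11 + timeFactor p q n (s + 1)) * W
  rw [Nat.add_mul, Nat.add_mul]
  omega

end

/-! ### Searching for chains, and the slice reduction -/

theorem REPred.exists_primrec {β : Type} [Primcodable β] {P : β → Prop} (hP : REPred P) :
    ∃ D : ℕ → β → Bool, Primrec₂ D ∧ (∀ j k x, j ≤ k → D j x → D k x) ∧
      ∀ x, P x ↔ ∃ k, D k x := by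
  obtain ⟨cd, hcd⟩ := Nat.Partrec.Code.exists_code.1 hP
  -- Evaluation with fuel `k` decides the `k`-th stage of the enumeration.
  refine ⟨fun k x => (cd.evaln k (Encodable.encode x)).isSome, ?_, ?_, fun x => ?_⟩
  · exact Primrec.option_isSome.comp (Nat.Partrec.Code.primrec_evaln.comp
      ((Primrec.fst.pair (Primrec.const cd)).pair (Primrec.encode.comp Primrec.snd)))
  · intro j k x hjk h
    obtain ⟨v, hv⟩ := Option.isSome_iff_exists.1 h
    exact Option.isSome_iff_exists.2 ⟨v, Nat.Partrec.Code.evaln_mono hjk hv⟩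
  · have h : P x ↔ (cd.eval (Encodable.encode x)).Dom := by
      rw [hcd]
      simp only [Encodable.encodek, Part.coe_some, Part.bind_some]
      exact ⟨fun h => ⟨h, trivial⟩, fun h => h.1⟩
    rw [h, Part.dom_iff_mem]
    constructor
    · rintro ⟨v, hv⟩
      obtain ⟨k, hk⟩ := Nat.Partrec.Code.evaln_complete.1 hv
      exact ⟨k, Option.isSome_iff_exists.2 ⟨v, hk⟩⟩
    · rintro ⟨k, hk⟩
      obtain ⟨v, hv⟩ := Option.isSome_iff_exists.1 hk
      exact ⟨v, Nat.Partrec.Code.evaln_sound hv⟩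

section

variable {α : Type} {C : Set (List α × List α)} {r : List α × List α × List α →. List α}

/-- For a computably enumerable relation, a chain between two strings can be found by an
algorithm, if there is one. -/
theorem exists_partrec_chain [Primcodable α] (hC : REPred fun p => p ∈ C) :
    ∃ c : List α × List α →. List (List α), Partrec c ∧
      (∀ u u', ∀ l ∈ c (u, u'), IsChainFromTo C u u' l) ∧
      ∀ u u' l, IsChainFromTo C u u' l → (c (u, u')).Dom := by
  classical
  obtain ⟨D, hD, hmono, hDC⟩ := hC.exists_primrec
  -- The search runs over a stage together with a list; a candidate is accepted if all its
  -- consecutive pairs have been enumerated by that stage and its ends are correct.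
  let check : List α × List α → ℕ × List (List α) → Bool := fun x y =>
    ((y.2.zip y.2.tail).foldr (fun p b => D y.1 p && b) true &&
      decide (y.2.head? = some x.1)) && decide (y.2.reverse.head? = some x.2)
  have hfold : ∀ k (ps : List (List α × List α)),
      ps.foldr (fun p b => D k p && b) true = true ↔ ∀ p ∈ ps, D k p = true := by
    intro k ps
    induction ps with
    | nil => simp
    | cons p ps ih => simp [ih]
  have hcheck : Primrec₂ check := by
    have hy : Primrec fun p : (List α × List α) × ℕ × List (List α) => p.2.2 :=
      Primrec.snd.comp Primrec.snd
    have hf : Primrec fun p : (List α × List α) × ℕ × List (List α) =>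
        (p.2.2.zip p.2.2.tail).foldr (fun x b => D p.2.1 x && b) true :=
      Primrec.list_foldr (primrec_zip_tail.comp hy) (Primrec.const true)
        (Primrec.and.comp (hD.comp (Primrec.fst.comp (Primrec.snd.comp Primrec.fst))
          (Primrec.fst.comp Primrec.snd)) (Primrec.snd.comp Primrec.snd)).to₂
    exact Primrec.and.comp (Primrec.and.comp hf
      (Primrec.eq.decide.comp (Primrec.list_head?.comp hy)
        (Primrec.option_some.comp (Primrec.fst.comp Primrec.fst))))
      (Primrec.eq.decide.comp (Primrec.list_head?.comp (Primrec.list_reverse.comp hy))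
        (Primrec.option_some.comp (Primrec.snd.comp Primrec.fst)))
  let c : List α × List α → ℕ → Option (List (List α)) := fun x k =>
    (Encodable.decode k : Option (ℕ × List (List α))).bind fun y =>
      cond (check x y) (some y.2) none
  have hc : Primrec₂ c :=
    Primrec.option_bind (Primrec.decode.comp Primrec.snd)
      (Primrec.cond (hcheck.comp (Primrec.fst.comp Primrec.fst) Primrec.snd)
        (Primrec.option_some.comp (Primrec.snd.comp Primrec.snd)) (Primrec.const none)).to₂
  refine ⟨_, Partrec.rfindOpt hc.to_comp, fun u u' l hl => ?_, fun u u' l hl => ?_⟩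
  · obtain ⟨n, hn⟩ := Nat.rfindOpt_spec hl
    obtain ⟨⟨k, l'⟩, -, hy⟩ := Option.bind_eq_some_iff.1 hn
    cases hb : check (u, u') (k, l') with
    | false => rw [hb] at hy; simp at hy
    | true =>
      rw [hb] at hy
      simp only [cond_true, Option.some.injEq] at hy
      subst hy
      simp only [check, Bool.and_eq_true, decide_eq_true_eq, hfold, List.head?_reverse] at hb
      exact ⟨isChain_iff_forall_mem_zip_tail.2 fun x hx => (hDC x).2 ⟨k, hb.1.1 x hx⟩,
        hb.1.2, hb.2⟩
  · obtain ⟨h1, h2, h3⟩ := hl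
    have hk : ∀ ps : List (List α × List α), (∀ x ∈ ps, x ∈ C) → ∃ k, ∀ x ∈ ps, D k x := by
      intro ps
      induction ps with
      | nil => simp
      | cons p ps ih =>
        intro h
        obtain ⟨k, hk⟩ := ih fun x hx => h x (List.mem_cons_of_mem _ hx)
        obtain ⟨j, hj⟩ := (hDC p).1 (h p (List.mem_cons_self ..))
        -- The stages increase, so a single one serves for all pairs of the chain.
        refine ⟨max j k, fun x hx => ?_⟩
        rcases List.mem_cons.1 hx with rfl | hx
        · exact hmono _ _ _ (le_max_left _ _) hj
        · exact hmono _ _ _ (le_max_right _ _) (hk x hx)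
    obtain ⟨k, hk⟩ := hk _ (isChain_iff_forall_mem_zip_tail.1 h1)
    refine Nat.rfindOpt_dom.2 ⟨Encodable.encode (k, l), l, ?_⟩
    have hb : check (u, u') (k, l) = true := by
      simp only [check, Bool.and_eq_true, decide_eq_true_eq, hfold, List.head?_reverse]
      exact ⟨⟨hk, h2⟩, h3⟩
    simp [c, hb]

theorem iterAlong_dom (hr : r.Dom = {x | (x.1, x.2.1) ∈ C}) (l : List (List α))
    (hl : l.IsChain fun a b => (a, b) ∈ C) (y : List α) : (iterAlong r l y).Dom := by
  induction l generalizing y with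
  | nil => trivial
  | cons u l ih =>
    cases l with
    | nil => trivial
    | cons v l =>
      rw [List.isChain_cons_cons] at hl
      have h : (u, v, y) ∈ r.Dom := by rw [hr]; exact hl.1
      obtain ⟨z, hz⟩ := Part.dom_iff_mem.1 h
      obtain ⟨x, hx⟩ := Part.dom_iff_mem.1 (ih hl.2 z)
      exact Part.dom_iff_mem.2 ⟨x, Part.mem_bind_iff.2 ⟨z, hz, hx⟩⟩

theorem iterAlong_correct {Q : Set (List α × List α)}
    (hr : ∀ u u', (u, u') ∈ C → ∀ y, ∀ z ∈ r (u, u', y), ((u, y) ∈ Q ↔ (u', z) ∈ Q))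
    {u u' : List α} {l : List (List α)} (hl : IsChainFromTo C u u' l) {y z : List α}
    (hz : z ∈ iterAlong r l y) : (u, y) ∈ Q ↔ (u', z) ∈ Q := by
  induction l generalizing u y with
  | nil => simp [IsChainFromTo] at hl
  | cons w l ih =>
    obtain ⟨h1, h2, h3⟩ := hl
    obtain rfl : w = u := by simpa using h2
    cases l with
    | nil =>
      obtain rfl : w = u' := by simpa using h3
      obtain rfl : z = y := Part.mem_some_iff.1 hz
      rfl
    | cons v l =>
      rw [List.isChain_cons_cons] at h1
      obtain ⟨y', hy', hz'⟩ := Part.mem_bind_iff.1 hz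
      rw [hr w v h1.1 y y' hy']
      exact ih ⟨h1.2, rfl, by simpa [List.getLast?_cons_cons] using h3⟩ hz'

/-- The strings with a chain into `S` form one of the sets that are intersected: one-element chains
give `S`, and a pair of `C` extends a chain at its front. -/
theorem exists_chain_of_mem_clo {S : Set (List α)} {s : List α} (hs : s ∈ clo C S) :
    ∃ s' ∈ S, ∃ l, IsChainFromTo C s s' l := by
  refine hs {s | ∃ s' ∈ S, ∃ l, IsChainFromTo C s s' l} ⟨fun t ht => ?_, ?_⟩
  · exact ⟨t, ht, [t], by simp [IsChainFromTo]⟩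
  · rintro u u' hu ⟨s', hs', l, h1, h2, h3⟩
    refine ⟨s', hs', u :: l, ?_, rfl, ?_⟩
    · cases l with
      | nil => simp
      | cons v l =>
        obtain rfl : v = u' := by simpa using h2
        exact List.isChain_cons_cons.2 ⟨hu, h1⟩
    · cases l with
      | nil => simp at h2
      | cons v l => rwa [List.getLast?_cons_cons]

end

theorem mainTheorem8 {α : Type} [Fintype α] [Primcodable α]
    (Q : Set (List α × List α)) (S : Set (List α))
    (C : Set (List α × List α)) (m : List α × List α → ℕ) (B : List α × List α →. ℕ)
    (r : List α × List α × List α →. List α)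
    (hr : IsAccordionReduction Q C m B r) :
    SliceReduces ⟨Q, clo C S⟩ ⟨Q, S⟩ ∧
      ∀ c : List α × List α →. List (List α), Partrec c →
        (∀ u u', ∀ l ∈ c (u, u'), IsChainFromTo C u u' l) →
        FPTComputable pairParam (fun x => (c (x.1, x.2.1)).bind fun l => iterAlong r l x.2.2) := by
  refine ⟨?_, fun c hc hchain => hr.fptComputable_iterAlong hc hchain⟩
  obtain ⟨c, hc, hchain, hdom⟩ := exists_partrec_chain hr.ce
  -- With `U` the domain of the search, coverage needs only that some chain exists; the one found
  -- may be different, and correctness holds along any chain.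
  refine ⟨c.Dom, fun x => (c (x.1, x.2.1)).bind fun l => iterAlong r l x.2.2,
    Partrec.dom_re hc, ?_, hr.fptComputable_iterAlong hc hchain, fun s hs => ?_, ?_⟩
  · ext ⟨u, u', y⟩
    refine ⟨fun h => ?_, fun h => ?_⟩
    · obtain ⟨z, hz⟩ := Part.dom_iff_mem.1 h
      obtain ⟨l, hl, -⟩ := Part.mem_bind_iff.1 hz
      exact Part.dom_iff_mem.2 ⟨l, hl⟩
    · obtain ⟨l, hl⟩ := Part.dom_iff_mem.1 h
      obtain ⟨z, hz⟩ := Part.dom_iff_mem.1 (iterAlong_dom hr.dom l (hchain u u' l hl).1 y)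
      exact Part.dom_iff_mem.2 ⟨z, Part.mem_bind_iff.2 ⟨l, hl, hz⟩⟩
  · obtain ⟨s', hs', l, hl⟩ := exists_chain_of_mem_clo hs
    exact ⟨s', hs', hdom s s' l hl⟩
  · intro t t' _ y z hz
    obtain ⟨l, hl, hz⟩ := Part.mem_bind_iff.1 hz
    exact iterAlong_correct hr.correctness (hchain t t' l hl) hz
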